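/- **Long-edge graphs.** A *long-edge graph* $G$ is a multigraph on the vertex set $\{0,1,2,\dots\}$ with finitely many edges and no loops, each edge $e$ from $i$ to $j$ ($i<j$) carrying a weight $\rho(e)\in\mathbb Z_{>0}$, such that no edge from $i$ to $i+1$ has weight $1$; parallel edges of equal weight are not distinguished. Put $\ell(e)=j-i$, $\mu(G)=\prod_e\rho(e)^2$ and $\delta(G)=\sum_e(\ell(e)\rho(e)-1)$ (the *cogenus*). Let $\mathrm{minv}(G)$ and $\mathrm{maxv}(G)$ be the smallest and largest vertices of nonzero degree, and $\ell(G)=\mathrm{maxv}(G)-\mathrm{minv}(G)$. Let $G_{(k)}$ be $G$ shifted to the right by $k$. Let $\lambda_j(G)$ be the sum of $\rho(e)$ over the edges from $i$ to $k$ with $i<j\le k$, and $\overline\lambda_j(G)=\lambda_j(G)-\#\{\text{edges from }j-1\text{ to }j\}$. Put $\epsilon_0(G)=1$ (resp. $\epsilon_1(G)=1$) if all edges adjacent to $\mathrm{minv}(G)$ (resp. $\mathrm{maxv}(G)$) have weight $1$, and $0$ otherwise. A *template* is a long-edge graph $\Gamma$ with $\mathrm{minv}(\Gamma)=0$ such that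 for every $1\le i\le\ell(\Gamma)-1$ some edge from $j$ to $k$ has $j<i<k$. There are finitely many templates of each cogenus $\delta\geq 1$. **The linear functions.** Let $\boldsymbol\beta=(\beta_0,\dots,\beta_M)\in\mathbb Z_{\ge0}^{M+1}$. Call $G$ *$\boldsymbol\beta$-allowable* (resp. *$\boldsymbol\beta$-semiallowable*) if $\mathrm{maxv}(G)\le M+1$ and $\beta_{j-1}\ge\lambda_j(G)$ (resp. $\beta_{j-1}\ge\overline\lambda_j(G)$) for $1\le j\le M+1$. If $G$ is $\boldsymbol\beta$-allowable, add $\beta_{j-1}-\lambda_j(G)$ unweighted edges from $j-1$ to $j$ for $1\le j\le M+1$, and let $P_{\boldsymbol\beta}(G)$ be the number of total orderings of the vertices and edges of the resulting graph that extend the natural order of the vertices and place each edge between its two end vertices, counted up to permutations of the edges that preserve end vertices and weights (or being unweighted). Otherwise put $P_{\boldsymbol\beta}(G)=0$. Define $$\Phi_{\boldsymbol\beta}(G)=\sum_{i\ge1}\frac{(-1)^{i+1}}{i}\sum_{(G_1,\dots,G_i)}\prod_{j=1}^iP_{\boldsymbol\beta}(G_j),$$ the inner sum being over all $i$-tuples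 of nonempty long-edge graphs whose weighted edge multisets have disjoint union equal to that of $G$. By a theorem of F. Liu there is a (necessarily unique) linear function $\Phi(G,\boldsymbol\beta)$ of $\boldsymbol\beta$, possibly with a constant term, such that $\Phi(G,\boldsymbol\beta)=\Phi_{\boldsymbol\beta}(G)$ whenever $G$ is $\boldsymbol\beta$-semiallowable. For a template $\Gamma$ of length $\ell$ write $\Phi(\Gamma,\boldsymbol\beta)=\eta_0(\Gamma)+\sum_{j=0}^{\ell-1}\eta_{j+1}(\Gamma)\beta_j$ and, for $i=0,1,2$, $\zeta^i(\Gamma)=\sum_{j=1}^{\ell}\binom{j-1}{i}\eta_j(\Gamma)$. **The linearized quantity and the coefficients.** For an integer sequence $\boldsymbol\beta=(\beta_0,\dots,\beta_M)$ and $\delta\ge1$ define $$Q_\delta(\boldsymbol\beta)=\sum_\Gamma\mu(\Gamma)\sum_{k=1-\epsilon_0(\Gamma)}^{M-\ell(\Gamma)+\epsilon_1(\Gamma)}\Phi(\Gamma_{(k)},\boldsymbol\beta),$$ and, with $r(\Gamma)=\ell(\Gamma)-\epsilon_0(\Gamma)-\epsilon_1(\Gamma)$, $$A(\delta)=\tfrac12\sum_\Gamma\mu(\Gamma)\zeta^0(\Gamma),\qquad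 L(\delta)=-\tfrac12\sum_\Gamma\mu(\Gamma)\zeta^0(\Gamma)r(\Gamma),\qquad H(\delta)=\sum_\Gamma\mu(\Gamma)\bigl(\eta_0(\Gamma)+\zeta^0(\Gamma)r(\Gamma)\bigr),$$ $$D(\delta)=-\sum_\Gamma\mu(\Gamma)\bigl(\zeta^2(\Gamma)+\zeta^1(\Gamma)(1-\epsilon_0(\Gamma))\bigr),\qquad C(\delta)=-\sum_\Gamma\mu(\Gamma)\eta_0(\Gamma)r(\Gamma),$$ where all sums over $\Gamma$ range over the templates of cogenus $\delta$. **Proposition.** Let $\delta\ge1$ and $M\ge\max(1,\delta-1)$ be integers, let $\boldsymbol d=(d_0,\dots,d_M)$ be a sequence of integers with $$d_1=d_2=\cdots=d_{\delta-1}\quad\text{and}\quad d_M=d_{M-1}=\cdots=d_{M+2-\delta},$$ and let $\boldsymbol\beta=\boldsymbol\beta(\boldsymbol d)=(d_0,\,d_0+d_1,\,\dots,\,d_0+\cdots+d_M)$. Then $$Q_\delta(\boldsymbol\beta)=A(\delta)\,\mathrm{area}(\boldsymbol\beta)+L(\delta)\,\mathrm{LL}(\boldsymbol\beta)+H(\delta)\,\mathrm{height}(\boldsymbol\beta)+D(\delta)\,\mathrm{idet}(\boldsymbol\beta)+C(\delta),$$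 where $\mathrm{area}(\boldsymbol\beta)=\beta_0+2\beta_1+\cdots+2\beta_{M-1}+\beta_M$, $\mathrm{LL}(\boldsymbol\beta)=\beta_0+\beta_M+2M$, $\mathrm{height}(\boldsymbol\beta)=M$ and $\mathrm{idet}(\boldsymbol\beta)=d_1-d_M$. -/

import Mathlib

noncomputable section

namespace Severi

/-- A weighted edge of a long-edge graph on the vertex set `ℕ`: it goes from `src` to `tgt` with
`src < tgt` (no loops), has positive weight, and is not short, that is, it does not have both
length one and weight one. -/
@[ext]
structure LongEdge where
  src : ℕ
  tgt : ℕ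
  wt : ℕ
  src_lt_tgt : src < tgt
  wt_pos : 0 < wt
  not_short : ¬ (tgt = src + 1 ∧ wt = 1)

instance : DecidableEq LongEdge := Classical.decEq _

/-- The length of an edge. -/
def LongEdge.len (e : LongEdge) : ℕ := e.tgt - e.src

/-- A long-edge graph has the fixed vertex set `ℕ` and finitely many edges, multiple edges being
allowed, so it is a finite multiset of weighted edges. -/
abbrev LongEdgeGraph := Multiset LongEdge

/-- The multiplicity `μ(G)`. -/
def mult (G : LongEdgeGraph) : ℕ := (G.map fun e => e.wt ^ 2).prod

/-- The cogenus `δ(G)`. -/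
def cogenus (G : LongEdgeGraph) : ℕ := (G.map fun e => e.len * e.wt - 1).sum

/-- The vertices of nonzero degree. -/
def verts (G : LongEdgeGraph) : Finset ℕ := (G.map LongEdge.src + G.map LongEdge.tgt).toFinset

/-- The smallest vertex of nonzero degree (`0` for the empty graph). -/
def minv (G : LongEdgeGraph) : ℕ := sInf (verts G : Set ℕ)

/-- The largest vertex of nonzero degree (`0` for the empty graph). -/
def maxv (G : LongEdgeGraph) : ℕ := (verts G).sup id

/-- The length of a long-edge graph. -/
def len (G : LongEdgeGraph) : ℕ := maxv G - minv G

/-- The edge shifted to the right by `k` units. -/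
def LongEdge.shift (k : ℕ) (e : LongEdge) : LongEdge where
  src := e.src + k
  tgt := e.tgt + k
  wt := e.wt
  src_lt_tgt := Nat.add_lt_add_right e.src_lt_tgt k
  wt_pos := e.wt_pos
  not_short := by
    have := e.not_short
    omega

/-- The shifted graph `G_(k)`. -/
def shift (k : ℕ) (G : LongEdgeGraph) : LongEdgeGraph := G.map (LongEdge.shift k)

/-- `λ_j(G)`: the total weight of the edges from `i` to `k` with `i < j ≤ k`. -/
def lam (G : LongEdgeGraph) (j : ℕ) : ℕ :=
  ((G.filter fun e => e.src < j ∧ j ≤ e.tgt).map LongEdge.wt).sum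

/-- `λ_j(G)` minus the number of edges from `j - 1` to `j`.  The subtraction does not truncate,
since each of these edges contributes at least one to `λ_j(G)`. -/
def lamBar (G : LongEdgeGraph) (j : ℕ) : ℕ :=
  lam G j - (G.filter fun e => e.src + 1 = j ∧ e.tgt = j).card

/-- `G` is `β`-allowable, where `β = (β_0, …, β_M)`. -/
def Allowable {M : ℕ} (β : Fin (M + 1) → ℕ) (G : LongEdgeGraph) : Prop :=
  maxv G ≤ M + 1 ∧ ∀ j : Fin (M + 1), lam G (j + 1) ≤ β j

/-- `G` is `β`-semiallowable, where `β = (β_0, …, β_M)`. -/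
def Semiallowable {M : ℕ} (β : Fin (M + 1) → ℕ) (G : LongEdgeGraph) : Prop :=
  maxv G ≤ M + 1 ∧ ∀ j : Fin (M + 1), lamBar G (j + 1) ≤ β j

/-- The kinds of edges in an extended graph: `Sum.inl e` is a weighted edge, and `Sum.inr j` is an
unweighted edge from `j` to `j + 1`. -/
abbrev ExtLabel (M : ℕ) := LongEdge ⊕ Fin (M + 1)

/-- The first vertex of an edge of an extended graph. -/
def ExtLabel.src {M : ℕ} : ExtLabel M → ℕ
  | Sum.inl e => e.src
  | Sum.inr j => j

/-- The last vertex of an edge of an extended graph. -/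
def ExtLabel.tgt {M : ℕ} : ExtLabel M → ℕ
  | Sum.inl e => e.tgt
  | Sum.inr j => j + 1

/-- The edges of the extended graph `ext_β(G)`: the edges of `G` together with
`β_j - λ_{j+1}(G)` unweighted edges from `j` to `j + 1`, for `0 ≤ j ≤ M`. -/
def ext {M : ℕ} (β : Fin (M + 1) → ℕ) (G : LongEdgeGraph) : Multiset (ExtLabel M) :=
  G.map Sum.inl + ∑ j : Fin (M + 1), Multiset.replicate (β j - lam G (j + 1)) (Sum.inr j)

/-- The vertices and the (individual) edges of `ext_β(G)`, to be ordered.  Only the vertices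
`0, …, M + 1` are listed: no edge of `ext_β(G)` goes beyond `M + 1` when `G` is `β`-allowable, and
the later vertices necessarily come, in their natural order, after everything else. -/
abbrev ExtItem {M : ℕ} (β : Fin (M + 1) → ℕ) (G : LongEdgeGraph) : Type :=
  Fin (M + 2) ⊕ (ext β G).ToType

/-- The strict total orders on the vertices and edges of `ext_β(G)` which extend the natural order
of the vertices and put every edge between its two end vertices. -/
structure ExtOrdering {M : ℕ} (β : Fin (M + 1) → ℕ) (G : LongEdgeGraph) where
  rel : ExtItem β G → ExtItem β G → Prop
  total : IsStrictTotalOrder (ExtItem β G) rel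
  vertices : ∀ a b : Fin (M + 2), a < b → rel (Sum.inl a) (Sum.inl b)
  after_src : ∀ (e : (ext β G).ToType) (a : Fin (M + 2)),
    (a : ℕ) = ExtLabel.src e.1 → rel (Sum.inl a) (Sum.inr e)
  before_tgt : ∀ (e : (ext β G).ToType) (a : Fin (M + 2)),
    (a : ℕ) = ExtLabel.tgt e.1 → rel (Sum.inr e) (Sum.inl a)

/-- Two extended orderings are equivalent if a permutation of the edges that preserves the end
vertices and the weights (or the property of being unweighted) carries one to the other. -/
def extSetoid {M : ℕ} (β : Fin (M + 1) → ℕ) (G : LongEdgeGraph) : Setoid (ExtOrdering β G) where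
  r o o' := ∃ σ : Equiv.Perm (ext β G).ToType, (∀ e, (σ e).1 = e.1) ∧
    ∀ x y, o'.rel (Sum.map id σ x) (Sum.map id σ y) ↔ o.rel x y
  iseqv :=
    { refl := fun o => ⟨Equiv.refl _, fun _ => rfl, fun x y => by simp⟩
      symm := by
        rintro o o' ⟨σ, h1, h2⟩
        refine ⟨σ.symm, fun e => ?_, fun x y => ?_⟩
        · have := h1 (σ.symm e)
          rw [Equiv.apply_symm_apply] at this
          exact this.symm
        · rw [← h2]
          simp [Sum.map_map]
      trans := by
        rintro o o' o'' ⟨σ, h1, h2⟩ ⟨τ, h3, h4⟩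
        refine ⟨σ.trans τ, fun e => ?_, fun x y => ?_⟩
        · simp [h3, h1]
        · rw [← h2, ← h4]
          simp [Sum.map_map] }

open Classical in
/-- `P_β(G)`: the number of equivalence classes of `β`-extended orderings of `G`, which by
convention is `0` if `G` is not `β`-allowable. -/
def P {M : ℕ} (β : Fin (M + 1) → ℕ) (G : LongEdgeGraph) : ℕ :=
  if Allowable β G then Nat.card (Quotient (extSetoid β G)) else 0

/-- The partitions of `G` into `i` parts: the `i`-tuples of nonempty long-edge graphs whose
disjoint union is `G`. -/
def partitions (G : LongEdgeGraph) (i : ℕ) : Finset (Fin i → LongEdgeGraph) :=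
  (Fintype.piFinset fun _ : Fin i => G.powerset.toFinset).filter
    fun f => (∀ j, f j ≠ 0) ∧ ∑ j, f j = G

/-- `Φ_β(G)`.  A graph has no partition with more parts than edges, so that the sum over all
`i ≥ 1` stops at the number of edges. -/
def Phi {M : ℕ} (β : Fin (M + 1) → ℕ) (G : LongEdgeGraph) : ℚ :=
  ∑ i ∈ Finset.Icc 1 (Multiset.card G),
    (-1 : ℚ) ^ (i + 1) / i * ∑ f ∈ partitions G i, ∏ j, (P β (f j) : ℚ)

/-- A linear function `c + ∑ a_i β_i` of the entries of a sequence `β`. -/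
@[ext]
structure LinFun where
  const : ℚ
  coeff : ℕ → ℚ

/-- The value of a linear function at `β = (β_0, …, β_M)`. -/
def LinFun.eval {M : ℕ} (f : LinFun) (β : Fin (M + 1) → ℤ) : ℚ :=
  f.const + ∑ i : Fin (M + 1), f.coeff i * (β i : ℚ)

/-- The linear function `f` agrees with `β ↦ Φ_β(G)` at all `β` for which `G` is
`β`-semiallowable. -/
def IsLinearization (G : LongEdgeGraph) (f : LinFun) : Prop :=
  ∀ (M : ℕ) (β : Fin (M + 1) → ℕ), Semiallowable β G → Phi β G = f.eval fun i => (β i : ℤ)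

theorem lamBar_le (G : LongEdgeGraph) (j : ℕ) : lamBar G j ≤ (G.map LongEdge.wt).sum := by
  refine (Nat.sub_le _ _).trans ?_
  unfold lam
  obtain ⟨H, hH⟩ := Multiset.le_iff_exists_add.mp
    (Multiset.filter_le (fun e : LongEdge => e.src < j ∧ j ≤ e.tgt) G)
  conv_rhs => rw [hH]
  simp

/-- There is at most one such linear function. -/
theorem IsLinearization.unique {G : LongEdgeGraph} {f g : LinFun} (hf : IsLinearization G f)
    (hg : IsLinearization G g) : f = g := by
  set B := (G.map LongEdge.wt).sum with hB
  have hsemi : ∀ (M : ℕ) (β : Fin (M + 1) → ℕ), maxv G ≤ M + 1 → (∀ j, B ≤ β j) →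
      f.eval (fun i => (β i : ℤ)) = g.eval (fun i => (β i : ℤ)) := fun M β hM hβ => by
    have hs : Semiallowable β G := ⟨hM, fun j => (lamBar_le G _).trans (hβ j)⟩
    rw [← hf M β hs, ← hg M β hs]
  have hc : f.coeff = g.coeff := by
    funext n
    let M := maxv G + n
    have h0 := hsemi M (fun _ => B) (by omega) (fun _ => le_rfl)
    let i₀ : Fin (M + 1) := ⟨n, by omega⟩
    have h1 := hsemi M (fun i => B + if i = i₀ then 1 else 0) (by omega)
      (fun _ => Nat.le_add_right _ _)
    simp only [LinFun.eval, Nat.cast_add, Int.cast_add, Int.cast_natCast, mul_add,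
      Finset.sum_add_distrib, Nat.cast_ite, Int.cast_ite, Int.cast_one, Int.cast_zero, Nat.cast_one, Nat.cast_zero, mul_ite, mul_one, mul_zero,
      Finset.sum_ite_eq', Finset.mem_univ, if_true] at h0 h1
    have : (i₀ : ℕ) = n := rfl
    rw [this] at h1
    linarith
  have h0 := hsemi (maxv G) (fun _ => B) (by omega) (fun _ => le_rfl)
  ext n
  · simp only [LinFun.eval, hc] at h0
    linarith
  · rw [hc]

open Classical in
/-- The linear function `β ↦ Φ(G, β)`: the unique linear function of `β` which equals `Φ_β(G)`
whenever `G` is `β`-semiallowable. -/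
def PhiLin (G : LongEdgeGraph) : LinFun :=
  if h : ∃ f, IsLinearization G f then h.choose else ⟨0, 0⟩

/-- A template is a long-edge graph that starts at the vertex `0` and in which every vertex `i`
with `1 ≤ i ≤ ℓ(Γ) - 1` lies strictly between the end vertices of some edge. -/
def IsTemplate (Γ : LongEdgeGraph) : Prop :=
  minv Γ = 0 ∧ ∀ i, 1 ≤ i → i < len Γ → ∃ e ∈ Γ, e.src < i ∧ i < e.tgt

theorem LongEdge.two_le (e : LongEdge) : 2 ≤ e.len * e.wt := by
  have h1 := e.src_lt_tgt
  have h2 := e.wt_pos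
  have h3 := e.not_short
  unfold LongEdge.len
  rcases Nat.lt_or_ge e.wt 2 with h | h
  · have : e.wt = 1 := by omega
    rw [this, mul_one]
    omega
  · have : 1 ≤ e.tgt - e.src := by omega
    nlinarith

theorem finite_templates (δ : ℕ) : {Γ | IsTemplate Γ ∧ cogenus Γ = δ}.Finite := by
  have hS : {e : LongEdge | e.tgt ≤ δ + 1 ∧ e.wt ≤ δ + 1}.Finite := by
    refine Set.Finite.of_finite_image (f := fun e : LongEdge => (e.src, e.tgt, e.wt)) ?_ ?_
    · refine Set.Finite.subset (Set.finite_Iic ((δ + 1, δ + 1, δ + 1) : ℕ × ℕ × ℕ)) ?_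
      rintro _ ⟨e, ⟨h1, h2⟩, rfl⟩
      exact ⟨e.src_lt_tgt.le.trans h1, h1, h2⟩
    · intro a _ b _ h
      simp only [Prod.mk.injEq] at h
      exact LongEdge.ext h.1 h.2.1 h.2.2
  refine Set.Finite.subset (Finset.finite_toSet (δ • hS.toFinset.val).powerset.toFinset) ?_
  rintro Γ ⟨⟨hmin, hT⟩, hδ⟩
  have hcard : Multiset.card Γ ≤ δ := by
    rw [← hδ]
    have := Multiset.card_nsmul_le_sum (s := Γ.map fun e => e.len * e.wt - 1) (a := 1) (by
      intro x hx
      obtain ⟨e, _, rfl⟩ := Multiset.mem_map.mp hx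
      have := e.two_le
      omega)
    simpa [cogenus] using this
  have hedge : ∀ e ∈ Γ, e.len * e.wt - 1 ≤ δ := fun e he => by
    rw [← hδ]
    exact Multiset.single_le_sum (by simp) _ (Multiset.mem_map_of_mem _ he)
  have hlen : len Γ - 1 ≤ δ := by
    have hsub : Finset.Ioo 0 (len Γ) ⊆ Γ.toFinset.biUnion fun e => Finset.Ioo e.src e.tgt := by
      intro i hi
      obtain ⟨h1, h2⟩ := Finset.mem_Ioo.mp hi
      obtain ⟨e, he, h⟩ := hT i h1 h2
      simp only [Finset.mem_biUnion, Multiset.mem_toFinset, Finset.mem_Ioo]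
      exact ⟨e, he, h⟩
    have h1 := (Finset.card_le_card hsub).trans Finset.card_biUnion_le
    simp only [Nat.card_Ioo] at h1
    have h2 : ∑ e ∈ Γ.toFinset, (e.tgt - e.src - 1) ≤ cogenus Γ := by
      unfold cogenus
      rw [Finset.sum_multiset_map_count]
      refine Finset.sum_le_sum fun e he => ?_
      have hc : 1 ≤ Γ.count e := Multiset.one_le_count_iff_mem.mpr (Multiset.mem_toFinset.mp he)
      have hw := e.wt_pos
      have : e.len ≤ e.len * e.wt := Nat.le_mul_of_pos_right _ hw
      have h3 : e.tgt - e.src - 1 ≤ e.len * e.wt - 1 := by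
        unfold LongEdge.len at *
        omega
      calc _ ≤ e.len * e.wt - 1 := h3
        _ = 1 • (e.len * e.wt - 1) := (one_smul _ _).symm
        _ ≤ _ := Nat.mul_le_mul_right _ hc
    omega
  have hmax : maxv Γ ≤ δ + 1 := by
    unfold len at hlen
    omega
  simp only [Finset.mem_coe, Multiset.mem_toFinset, Multiset.mem_powerset]
  rw [Multiset.le_iff_count]
  intro e
  by_cases he : e ∈ Γ
  · have hmem : e ∈ hS.toFinset := by
      rw [Set.Finite.mem_toFinset]
      constructor
      · refine le_trans ?_ hmax
        have : e.tgt ∈ verts Γ := by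
          unfold verts
          rw [Multiset.mem_toFinset, Multiset.mem_add]
          exact Or.inr (Multiset.mem_map_of_mem _ he)
        exact Finset.le_sup (f := id) this
      · have h1 := hedge e he
        have : e.wt ≤ e.len * e.wt := Nat.le_mul_of_pos_left _ (by
          have := e.src_lt_tgt
          unfold LongEdge.len
          omega)
        omega
    rw [Multiset.count_nsmul, Multiset.count_eq_one_of_mem hS.toFinset.nodup hmem, mul_one]
    exact (Multiset.count_le_card _ _).trans hcard
  · rw [Multiset.count_eq_zero_of_notMem he]
    exact Nat.zero_le _

/-- The templates of cogenus `δ`. -/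
def templates (δ : ℕ) : Finset LongEdgeGraph := (finite_templates δ).toFinset

open Classical in
/-- `ε_0(G)`: one if all edges adjacent to the first vertex of `G` have weight one, else zero. -/
def eps0 (G : LongEdgeGraph) : ℕ :=
  if ∀ e ∈ G, e.src = minv G ∨ e.tgt = minv G → e.wt = 1 then 1 else 0

open Classical in
/-- `ε_1(G)`: one if all edges adjacent to the last vertex of `G` have weight one, else zero. -/
def eps1 (G : LongEdgeGraph) : ℕ :=
  if ∀ e ∈ G, e.src = maxv G ∨ e.tgt = maxv G → e.wt = 1 then 1 else 0

/-- `Q_Γ(β) = μ(Γ) ∑_k Φ(Γ_(k), β)`, over `1 - ε_0(Γ) ≤ k ≤ M - ℓ(Γ) + ε_1(Γ)`. -/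
def QTemplate {M : ℕ} (Γ : LongEdgeGraph) (β : Fin (M + 1) → ℤ) : ℚ :=
  mult Γ * ∑ k ∈ (Finset.range (M + 2)).filter
    (fun k => 1 ≤ k + eps0 Γ ∧ k + len Γ ≤ M + eps1 Γ), (PhiLin (shift k Γ)).eval β

/-- The linearized quantity `Q_δ(β)`. -/
def Q {M : ℕ} (δ : ℕ) (β : Fin (M + 1) → ℤ) : ℚ := ∑ Γ ∈ templates δ, QTemplate Γ β

/-- The coefficients of `Φ(Γ, β) = η_0 + ∑ η_{j+1} β_j`. -/
def eta (Γ : LongEdgeGraph) : ℕ → ℚ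
  | 0 => (PhiLin Γ).const
  | j + 1 => (PhiLin Γ).coeff j

/-- `ζ^i(Γ)`. -/
def zeta (i : ℕ) (Γ : LongEdgeGraph) : ℚ :=
  ∑ j ∈ Finset.Icc 1 (len Γ), ((j - 1).choose i : ℚ) * eta Γ j

/-- `ℓ(Γ) - ε_0(Γ) - ε_1(Γ)`. -/
def redLen (Γ : LongEdgeGraph) : ℚ := (len Γ : ℚ) - eps0 Γ - eps1 Γ

/-- The coefficient `A(δ)`. -/
def coefA (δ : ℕ) : ℚ := 1 / 2 * ∑ Γ ∈ templates δ, (mult Γ : ℚ) * zeta 0 Γ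

/-- The coefficient `L(δ)`. -/
def coefL (δ : ℕ) : ℚ := -(1 / 2) * ∑ Γ ∈ templates δ, (mult Γ : ℚ) * (zeta 0 Γ * redLen Γ)

/-- The coefficient `H(δ)`. -/
def coefH (δ : ℕ) : ℚ :=
  ∑ Γ ∈ templates δ, (mult Γ : ℚ) * (eta Γ 0 + zeta 0 Γ * redLen Γ)

/-- The coefficient `D(δ)`. -/
def coefD (δ : ℕ) : ℚ :=
  -∑ Γ ∈ templates δ, (mult Γ : ℚ) * (zeta 2 Γ + zeta 1 Γ * (1 - eps0 Γ))

/-- The coefficient `C(δ)`. -/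
def coefC (δ : ℕ) : ℚ := -∑ Γ ∈ templates δ, (mult Γ : ℚ) * (eta Γ 0 * redLen Γ)

/-- `β(d) = (d_0, d_0 + d_1, …, d_0 + ⋯ + d_M)`. -/
def partialSums {M : ℕ} (d : Fin (M + 1) → ℤ) : Fin (M + 1) → ℤ :=
  fun i => ∑ j ∈ Finset.Iic i, d j

/-- `area(β) = β_0 + 2 β_1 + ⋯ + 2 β_{M-1} + β_M`. -/
def area {M : ℕ} (β : Fin (M + 1) → ℤ) : ℤ :=
  β 0 + 2 * ∑ i ∈ Finset.Ioo 0 (Fin.last M), β i + β (Fin.last M)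

/-- `LL(β) = β_0 + β_M + 2 M`. -/
def LL {M : ℕ} (β : Fin (M + 1) → ℤ) : ℤ := β 0 + β (Fin.last M) + 2 * M

/-- `height(β) = M`. -/
def height {M : ℕ} (_β : Fin (M + 1) → ℤ) : ℤ := M

/-- `idet(β) = d_1 - d_M` in terms of the differences `d_1 = β_1 - β_0` and
`d_M = β_M - β_{M-1}`, for `M ≥ 1`. -/
def idet {M : ℕ} (β : Fin (M + 1) → ℤ) : ℤ :=
  (β 1 - β 0) - (β (Fin.last M) - β (Fin.last M - 1))

end Severi

end

noncomputable section

namespace Severi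

/-! By translation equivariance, `Φ(Γ_(k), β) = η_0 + ∑_j η_{j+1} β_{j+k}`. For fixed `j`, the sum
of `β_{j+k}` over the admissible `k` is the sum of all `β_i`, less the first `j + 1 - ε_0` and the
last `ℓ - ε_1 - j` entries. A template of cogenus `δ` has `ℓ ≤ δ + ε_0` and `ℓ ≤ δ + ε_1`, so at
most `δ` entries are missing at either end. There the hypotheses on `d` make `β` an arithmetic
progression, and `n` missing entries add up to `n β_0 + binom(n,2) d_1`, respectively `n β_M -
binom(n,2) d_M`. This is `QTemplate_eq`.

Reflection is an involution on the templates of cogenus `δ` that preserves `μ`, exchanges `ε_0` and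
`ε_1` and reverses the `η_j` with `j ≥ 1`. Hence the corrections at the two ends have equal totals
over all templates. The numbers missing at the two ends add up to `1 + r`, whatever `j` is, which
gives the coefficients of `β_0 + β_M`; the binomials give `D(δ)`. This is `Q_eq`.

Both symmetries rest on `PhiLin_rev`: reflecting the graph reverses the variables of its linear
function. A translation is a product of two reflections (`shift_eq_rev_rev`). To prove `PhiLin_rev`,
`P_β(G)` is rewritten as a number of words (`P_eq_wordCount`), which does not depend on the ambient
interval (`wordCount_eq`) and is invariant under reading backwards (`wordCount_rev`). The existence
of the linear functions is not needed, because the default value zero has the same symmetry. -/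

/-! ### Words with prescribed letters and prescribed precedences -/

/-- The number of words with letter multiset `S` in which no letter is followed by one that has to
precede it. -/
def numWords {α : Type*} (prec : α → α → Prop) (S : Multiset α) : ℕ :=
  Nat.card {w : List α // (w : Multiset α) = S ∧ w.Pairwise fun x y => ¬ prec y x}

section Words

variable {α : Type*} {prec : α → α → Prop}

open Classical in
/-- Insert `x` right after the letters that have to precede it. -/
def insertLetter (prec : α → α → Prop) (x : α) (w : List α) : List α :=
  w.filter (fun y => prec y x) ++ x :: w.filter (fun y => ¬ prec y x)

open Classical in
-- The letters before `x` form an initial segment: if `a` is `x` or comes after `x`, a later letter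
-- preceding `x` would also precede `a`, which the word forbids.
theorem filter_prec_append (ht : ∀ a b c, prec a b → prec b c → prec a c) {x : α} {w : List α}
    (hw : w.Pairwise fun x y => ¬ prec y x) (hx : ∀ y ∈ w, y = x ∨ prec x y ∨ prec y x) :
    w.filter (fun y => prec y x) ++ w.filter (fun y => ¬ prec y x) = w := by
  induction w with
  | nil => rfl
  | cons a t ih =>
    rw [List.pairwise_cons] at hw
    have ih := ih hw.2 fun y hy => hx y (List.mem_cons_of_mem _ hy)
    by_cases ha : prec a x
    · simpa [List.filter_cons, ha] using ih
    · have h : ∀ u ∈ t, ¬ prec u x := fun u hu hux => by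
        rcases hx a List.mem_cons_self with rfl | h | h
        · exact hw.1 u hu hux
        · exact hw.1 u hu (ht _ _ _ hux h)
        · exact ha h
      have h1 : t.filter (fun y => prec y x) = [] := by simpa using h
      rw [h1, List.nil_append] at ih
      simp only [List.filter_cons, ha, decide_false, Bool.false_eq_true, if_false,
        not_false_eq_true, decide_true, if_true, h1, List.nil_append, ih]

open Classical in
theorem insertLetter_erase {x : α} {w : List α}
    (hw : w.Pairwise fun x y => ¬ prec y x) (hxw : x ∈ w)
    (hx : ∀ y ∈ w, y = x ∨ prec x y ∨ prec y x) :
    insertLetter prec x (w.erase x) = w := by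
  induction w with
  | nil => simp at hxw
  | cons a t ih =>
    rw [List.pairwise_cons] at hw
    by_cases hax : a = x
    · subst hax
      have h1 : t.filter (fun y => prec y a) = [] := by simpa using hw.1
      have h2 : t.filter (fun y => ¬ prec y a) = t := by simpa using hw.1
      rw [List.erase_cons_head, insertLetter, h1, h2, List.nil_append]
    · have hxt : x ∈ t := by simpa [Ne.symm hax] using hxw
      have hpa : prec a x := by
        rcases hx a List.mem_cons_self with h | h | h
        · exact absurd h hax
        · exact absurd h (hw.1 x hxt)
        · exact h
      have ih := ih hw.2 hxt fun y hy => hx y (List.mem_cons_of_mem _ hy)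
      rw [List.erase_cons_tail (by simpa using hax)]
      simpa [insertLetter, List.filter_cons, hpa] using ih

open Classical in
/-- A letter that is comparable to all letters has only one possible place. -/
theorem numWords_cons (hi : ∀ a, ¬ prec a a) (ht : ∀ a b c, prec a b → prec b c → prec a c)
    {x : α} {S : Multiset α} (hx : ∀ y ∈ S, y = x ∨ prec x y ∨ prec y x) :
    numWords prec (x ::ₘ S) = numWords prec S := by
  unfold numWords
  -- Erasing one copy of `x` is the bijection; `insertLetter` inverts it.
  refine Nat.card_eq_of_bijective (fun w => ⟨w.1.erase x, ?_, ?_⟩) ⟨?_, ?_⟩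
  · rw [← Multiset.coe_erase, w.2.1, Multiset.erase_cons_head]
  · exact w.2.2.sublist List.erase_sublist
  · rintro ⟨w, hw, hp⟩ ⟨w', hw', hp'⟩ h
    simp only [Subtype.mk.injEq] at h ⊢
    have key : ∀ v : List α, (v : Multiset α) = x ::ₘ S → v.Pairwise (fun x y => ¬ prec y x) →
        insertLetter prec x (v.erase x) = v := fun v hv hpv => by
      refine insertLetter_erase hpv ?_ fun y hy => ?_
      · rw [← Multiset.mem_coe, hv]
        exact Multiset.mem_cons_self _ _
      · rw [← Multiset.mem_coe, hv, Multiset.mem_cons] at hy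
        rcases hy with h | h
        · exact Or.inl h
        · exact hx y h
    rw [← key w hw hp, ← key w' hw' hp', h]
  · rintro ⟨w, rfl, hp⟩
    have hsplit := filter_prec_append ht hp (x := x) hx
    have hnot : x ∉ w.filter (fun y => prec y x) := by simp [hi]
    refine ⟨⟨insertLetter prec x w, ?_, ?_⟩, ?_⟩
    · rw [insertLetter, Multiset.cons_coe, Multiset.coe_eq_coe]
      refine List.perm_middle.trans ?_
      rw [hsplit]
    · have hp' := hp
      rw [← hsplit, List.pairwise_append] at hp'
      rw [insertLetter, List.pairwise_append, List.pairwise_cons]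
      refine ⟨hp'.1, ⟨fun b hb => ?_, hp'.2.1⟩, fun a ha b hb => ?_⟩
      · simpa using (List.mem_filter.mp hb).2
      · rcases List.mem_cons.mp hb with rfl | hb
        · have : prec a b := by simpa using (List.mem_filter.mp ha).2
          exact fun h => hi _ (ht _ _ _ h this)
        · exact hp'.2.2 a ha b hb
    · simp only [Subtype.mk.injEq]
      rw [insertLetter, List.erase_append_right _ hnot, List.erase_cons_head, hsplit]

theorem numWords_add (hi : ∀ a, ¬ prec a a) (ht : ∀ a b c, prec a b → prec b c → prec a c)
    {R S : Multiset α} (hx : ∀ x ∈ R, ∀ y ∈ R + S, y = x ∨ prec x y ∨ prec y x) :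
    numWords prec (R + S) = numWords prec S := by
  induction R using Multiset.induction with
  | empty => rw [zero_add]
  | cons a R ih =>
    rw [Multiset.cons_add] at hx ⊢
    rw [numWords_cons hi ht fun y hy => hx a (Multiset.mem_cons_self _ _) y
      (Multiset.mem_cons_of_mem hy)]
    exact ih fun x hxR y hy => hx x (Multiset.mem_cons_of_mem hxR) y (Multiset.mem_cons_of_mem hy)

/-- Words can be read backwards. -/
theorem numWords_map_reverse {f : α → α} {S : Multiset α} (hf : ∀ x ∈ S, f (f x) = x)
    (hprec : ∀ x ∈ S, ∀ y ∈ S, prec (f x) (f y) ↔ prec y x) :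
    numWords prec (S.map f) = numWords prec S := by
  symm
  unfold numWords
  have hid : ∀ w : List α, (∀ x ∈ w, f (f x) = x) → ((w.map f).reverse.map f).reverse = w := by
    intro w hw
    rw [List.map_reverse, List.reverse_reverse, List.map_map]
    conv_rhs => rw [← List.map_id w]
    exact List.map_congr_left hw
  refine Nat.card_congr ⟨fun w => ⟨(w.1.map f).reverse, ?_, ?_⟩,
    fun w => ⟨(w.1.map f).reverse, ?_, ?_⟩, ?_, ?_⟩
  · rw [Multiset.coe_reverse, ← Multiset.map_coe, w.2.1]
  · rw [List.pairwise_reverse, List.pairwise_map]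
    refine List.Pairwise.imp_of_mem (fun {a b} ha hb h => ?_) w.2.2
    rw [← Multiset.mem_coe, w.2.1] at ha hb
    rwa [hprec _ ha _ hb]
  · rw [Multiset.coe_reverse, ← Multiset.map_coe, w.2.1, Multiset.map_map]
    conv_rhs => rw [← Multiset.map_id S]
    exact Multiset.map_congr rfl hf
  · rw [List.pairwise_reverse, List.pairwise_map]
    refine List.Pairwise.imp_of_mem (fun {a b} ha hb h => ?_) w.2.2
    rw [← Multiset.mem_coe, w.2.1, Multiset.mem_map] at ha hb
    obtain ⟨a, ha, rfl⟩ := ha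
    obtain ⟨b, hb, rfl⟩ := hb
    rwa [hf a ha, hf b hb, ← hprec _ hb _ ha]
  · rintro ⟨w, rfl, hw⟩
    simp only [Subtype.mk.injEq]
    exact hid w hf
  · rintro ⟨w, h, hw⟩
    simp only [Subtype.mk.injEq]
    refine hid w fun x hx => ?_
    rw [← Multiset.mem_coe, h, Multiset.mem_map] at hx
    obtain ⟨a, ha, rfl⟩ := hx
    rw [hf a ha]

end Words

/-! ### Orders and enumerations -/

section Enumeration

theorem rel_getElem_iff {X : Type*} (r : X → X → Prop) [IsStrictTotalOrder X r] {l : List X}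
    (h : l.Pairwise r) {i j : ℕ} (hi : i < l.length) (hj : j < l.length) :
    r l[i] l[j] ↔ i < j := by
  rw [List.pairwise_iff_getElem] at h
  refine ⟨fun hr => ?_, fun hij => h i j hi hj hij⟩
  rcases lt_trichotomy i j with hij | rfl | hij
  · exact hij
  · exact absurd hr (irrefl _)
  · exact absurd (_root_.trans hr (h j i hj hi hij)) (irrefl _)

variable {X : Type*} [Fintype X]

open Classical in
theorem exists_enumeration (r : X → X → Prop) [IsStrictTotalOrder X r] :
    ∃ l : List X, (l : Multiset X) = Finset.univ.val ∧ l.Pairwise r := by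
  let := linearOrderOfSTO r
  refine ⟨Finset.univ.sort, Finset.sort_eq _ _, ?_⟩
  exact (Finset.sortedLT_sort (Finset.univ : Finset X)).pairwise

theorem enumeration_unique (r : X → X → Prop) [IsStrictTotalOrder X r] {l l' : List X}
    (hl : (l : Multiset X) = Finset.univ.val) (hl' : (l' : Multiset X) = Finset.univ.val)
    (h : l.Pairwise r) (h' : l'.Pairwise r) : l = l' :=
  List.Perm.eq_of_pairwise (le := r) (fun a _ _ _ hab hba => absurd (_root_.trans hab hba) (irrefl a))
    h h' (Multiset.coe_eq_coe.mp (hl.trans hl'.symm))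

theorem enumeration_nodup {l : List X} (hl : (l : Multiset X) = Finset.univ.val) : l.Nodup := by
  rw [← Multiset.coe_nodup, hl]
  exact Finset.univ.nodup

theorem mem_enumeration {l : List X} (hl : (l : Multiset X) = Finset.univ.val) (x : X) : x ∈ l := by
  rw [← Multiset.mem_coe, hl]
  exact Finset.mem_univ x

open Classical in
/-- Two enumerations of a type differ by a permutation of the type, which preserves the labels if
the enumerations have the same sequence of labels. -/
theorem exists_perm_of_map_eq {α : Type*} (f : X → α) {r r' : X → X → Prop}
    [IsStrictTotalOrder X r] [IsStrictTotalOrder X r'] {l l' : List X}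
    (hl : (l : Multiset X) = Finset.univ.val) (hl' : (l' : Multiset X) = Finset.univ.val)
    (h : l.Pairwise r) (h' : l'.Pairwise r') (hf : l.map f = l'.map f) :
    ∃ σ : Equiv.Perm X, (∀ x, f (σ x) = f x) ∧ ∀ x y, r' (σ x) (σ y) ↔ r x y := by
  let e := (enumeration_nodup hl).getEquivOfForallMemList l (mem_enumeration hl)
  let e' := (enumeration_nodup hl').getEquivOfForallMemList l' (mem_enumeration hl')
  have hlen : l.length = l'.length := by simpa using congrArg List.length hf
  let c : Fin l.length ≃ Fin l'.length := finCongr hlen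
  have he : ∀ i, e i = l[i] := fun i => rfl
  have hσ : ∀ i, ((e.symm.trans c).trans e') (e i) = l'[(i : ℕ)]'(hlen ▸ i.2) := fun i => by
    rw [Equiv.trans_apply, Equiv.trans_apply, Equiv.symm_apply_apply]
    rfl
  refine ⟨(e.symm.trans c).trans e', fun x => ?_, fun x y => ?_⟩
  · obtain ⟨i, rfl⟩ := e.surjective x
    rw [hσ, he]
    have h1 : (l.map f)[(i : ℕ)]'(by simp) = (l'.map f)[(i : ℕ)]'(by simp [← hlen]) := by
      simp only [hf]
    simpa using h1.symm
  · obtain ⟨i, rfl⟩ := e.surjective x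
    obtain ⟨j, rfl⟩ := e.surjective y
    rw [hσ, hσ, rel_getElem_iff r' h']
    exact (rel_getElem_iff r h i.2 j.2).symm

/-- This makes every word come from an enumeration: a rearrangement of the labels lifts to the
labelled objects along each generating step of `List.Perm`. -/
theorem exists_map_eq_of_coe_eq {α : Type*} (f : X → α) {w : List α}
    (hw : (w : Multiset α) = Finset.univ.val.map f) :
    ∃ l : List X, (l : Multiset X) = Finset.univ.val ∧ l.map f = w := by
  have key : ∀ u w : List α, u.Perm w → ∀ l : List X, l.map f = u →
      ∃ l' : List X, l'.Perm l ∧ l'.map f = w := by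
    intro u w h
    induction h with
    | nil => exact fun l hl => ⟨l, List.Perm.refl _, hl⟩
    | cons x _ ih =>
      intro l hl
      obtain ⟨a, t, rfl, rfl, ht⟩ := List.map_eq_cons_iff.mp hl
      obtain ⟨t', h1, h2⟩ := ih t ht
      exact ⟨a :: t', h1.cons a, by rw [List.map_cons, h2]⟩
    | swap x y _ =>
      intro l hl
      obtain ⟨a, t, rfl, rfl, ht⟩ := List.map_eq_cons_iff.mp hl
      obtain ⟨b, s, rfl, rfl, rfl⟩ := List.map_eq_cons_iff.mp ht
      exact ⟨b :: a :: s, List.Perm.swap _ _ _, rfl⟩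
    | trans _ _ ih1 ih2 =>
      intro l hl
      obtain ⟨l', h1, h2⟩ := ih1 l hl
      obtain ⟨l'', h3, h4⟩ := ih2 l' h2
      exact ⟨l'', h3.trans h1, h4⟩
  have hu : ((Finset.univ : Finset X).toList.map f : Multiset α) = w := by
    rw [hw, ← Multiset.map_coe, Finset.coe_toList]
  obtain ⟨l, h1, h2⟩ := key _ w (Multiset.coe_eq_coe.mp hu) _ rfl
  exact ⟨l, by rw [Multiset.coe_eq_coe.mpr h1, Finset.coe_toList], h2⟩

open Classical in
/-- The order in which a list enumerates a type. -/
theorem exists_order_of_enumeration {l : List X} (hl : (l : Multiset X) = Finset.univ.val) :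
    ∃ r : X → X → Prop, IsStrictTotalOrder X r ∧ l.Pairwise r := by
  let e := (enumeration_nodup hl).getEquivOfForallMemList l (mem_enumeration hl)
  have he : ∀ i, e i = l[i] := fun i => rfl
  refine ⟨fun x y => e.symm x < e.symm y,
    { trichotomous := fun a b h1 h2 => e.symm.injective (le_antisymm (not_lt.mp h2) (not_lt.mp h1))
      irrefl := fun a => lt_irrefl _
      trans := fun a b c => lt_trans }, ?_⟩
  rw [List.pairwise_iff_getElem]
  intro i j hi hj hij
  have h1 : e.symm l[i] = ⟨i, hi⟩ := by rw [Equiv.symm_apply_eq]; rfl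
  have h2 : e.symm l[j] = ⟨j, hj⟩ := by rw [Equiv.symm_apply_eq]; rfl
  rw [h1, h2]
  exact hij

end Enumeration

/-! ### The letters of extended orderings -/

/-- The vertices, weighted edges and unweighted edges of extended graphs. -/
inductive Letter where
  | vertex (a : ℕ)
  | edge (e : LongEdge)
  | short (j : ℕ)

/-- The left end of the interval that represents a letter. -/
def Letter.lo : Letter → ℕ
  | vertex a => 2 * a
  | edge e => 2 * e.src + 1
  | short j => 2 * j + 1

/-- The right end of the interval that represents a letter. -/
def Letter.hi : Letter → ℕ
  | vertex a => 2 * a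
  | edge e => 2 * e.tgt - 1
  | short j => 2 * j + 1

/-- The letter `x` precedes the letter `y` in every extended ordering. -/
def Letter.prec (x y : Letter) : Prop := x.hi < y.lo

/-- A vertex `a` is the point `2a`, and an edge from `i` to `k` is the interval from `2i + 1` to `2k
- 1`. Precedence is thus an interval order, and comparability becomes linear arithmetic. -/
theorem Letter.lo_le_hi (x : Letter) : x.lo ≤ x.hi := by
  cases x with
  | vertex a => exact le_rfl
  | edge e => have := e.src_lt_tgt; simp only [lo, hi]; omega
  | short j => exact le_rfl

theorem Letter.prec_irrefl (x : Letter) : ¬ x.prec x := not_lt.mpr x.lo_le_hi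

theorem Letter.prec_trans (x y z : Letter) (h : x.prec y) (h' : y.prec z) : x.prec z :=
  lt_of_lt_of_le h (y.lo_le_hi.trans h'.le)

/-- The letters of the extended graph of `H` on the vertices `0, …, n`. -/
def letters (n : ℕ) (b : ℕ → ℕ) (H : LongEdgeGraph) : Multiset Letter :=
  (Finset.range (n + 1)).val.map Letter.vertex + (H.map Letter.edge +
    ∑ j ∈ Finset.range n, Multiset.replicate (b j - lam H (j + 1)) (Letter.short j))

open Classical in
/-- The number of extended orderings on the vertices `0, …, n`, counted as words. -/
def wordCount (n : ℕ) (b : ℕ → ℕ) (H : LongEdgeGraph) : ℕ :=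
  if ∀ j < n, lam H (j + 1) ≤ b j then numWords Letter.prec (letters n b H) else 0

/-- The letter of an edge of an extended graph. -/
def extLetter {M : ℕ} : ExtLabel M → Letter
  | Sum.inl e => Letter.edge e
  | Sum.inr j => Letter.short j

theorem extLetter_injective {M : ℕ} : Function.Injective (extLetter (M := M)) := by
  rintro (e | i) (f | j) h <;> simp only [extLetter, Letter.edge.injEq, Letter.short.injEq,
    reduceCtorEq] at h
  · rw [h]
  · rw [Fin.ext h]

theorem lo_extLetter {M : ℕ} (x : ExtLabel M) : (extLetter x).lo = 2 * ExtLabel.src x + 1 := by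
  cases x <;> rfl

theorem hi_extLetter {M : ℕ} (x : ExtLabel M) : (extLetter x).hi + 1 = 2 * ExtLabel.tgt x := by
  cases x with
  | inl e =>
    have := e.src_lt_tgt
    simp only [extLetter, Letter.hi, ExtLabel.tgt]
    omega
  | inr j => simp only [extLetter, Letter.hi, ExtLabel.tgt]; omega

/-- The letter of a vertex or edge of an extended graph. -/
def itemLetter {M : ℕ} (β : Fin (M + 1) → ℕ) (G : LongEdgeGraph) : ExtItem β G → Letter
  | Sum.inl a => Letter.vertex a
  | Sum.inr e => extLetter e.1

/-- Extension of a finite sequence by zeros. -/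
def extendZero {M : ℕ} (β : Fin (M + 1) → ℕ) (j : ℕ) : ℕ := if h : j < M + 1 then β ⟨j, h⟩ else 0

theorem extendZero_coe {M : ℕ} (β : Fin (M + 1) → ℕ) (j : Fin (M + 1)) :
    extendZero β j = β j := dif_pos j.2

theorem map_itemLetter {M : ℕ} (β : Fin (M + 1) → ℕ) (G : LongEdgeGraph) :
    (Finset.univ : Finset (ExtItem β G)).val.map (itemLetter β G) =
      letters (M + 1) (extendZero β) G := by
  rw [← Finset.univ_disjSum_univ, Finset.val_disjSum, Multiset.disjSum, Multiset.map_add,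
    Multiset.map_map, Multiset.map_map, letters]
  congr 1
  · have : (Finset.range (M + 1 + 1)).val =
        (Finset.univ : Finset (Fin (M + 2))).val.map Fin.val := by
      rw [← Nat.Iio_eq_range, ← Fin.map_valEmbedding_univ, Finset.map_val]
      rfl
    rw [this, Multiset.map_map]
    rfl
  · have h1 : (Finset.univ : Finset (ext β G).ToType).val.map (itemLetter β G ∘ Sum.inr) =
        (ext β G).map extLetter := by
      conv_rhs => rw [← Multiset.map_univ_coe (ext β G), Multiset.map_map]
      rfl
    rw [h1, ext, Multiset.map_add, Multiset.map_map]
    congr 1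
    rw [Finset.sum_range, ← Multiset.coe_mapAddMonoidHom, map_sum]
    refine Finset.sum_congr rfl fun j _ => ?_
    rw [Multiset.coe_mapAddMonoidHom, Multiset.map_replicate, extendZero_coe]
    rfl

theorem le_maxv {G : LongEdgeGraph} {e : LongEdge} (he : e ∈ G) : e.tgt ≤ maxv G := by
  have : e.tgt ∈ verts G := by
    unfold verts
    rw [Multiset.mem_toFinset, Multiset.mem_add]
    exact Or.inr (Multiset.mem_map_of_mem _ he)
  exact Finset.le_sup (f := id) this

theorem maxv_le_iff {G : LongEdgeGraph} {n : ℕ} : maxv G ≤ n ↔ ∀ e ∈ G, e.tgt ≤ n := by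
  refine ⟨fun h e he => (le_maxv he).trans h, fun h => Finset.sup_le fun v hv => ?_⟩
  unfold verts at hv
  rw [Multiset.mem_toFinset, Multiset.mem_add, Multiset.mem_map, Multiset.mem_map] at hv
  rcases hv with ⟨e, he, rfl⟩ | ⟨e, he, rfl⟩
  · exact e.src_lt_tgt.le.trans (h e he)
  · exact h e he

theorem mem_ext {M : ℕ} {β : Fin (M + 1) → ℕ} {G : LongEdgeGraph} {x : ExtLabel M}
    (hx : x ∈ ext β G) : (∃ e ∈ G, x = Sum.inl e) ∨ ∃ j, x = Sum.inr j := by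
  cases x with
  | inr j => exact Or.inr ⟨j, rfl⟩
  | inl e =>
    left
    rw [ext, Multiset.mem_add, Multiset.mem_map, Multiset.mem_sum] at hx
    rcases hx with ⟨f, hf, h⟩ | ⟨j, _, hj⟩
    · exact ⟨f, hf, h.symm⟩
    · exact absurd (Multiset.eq_of_mem_replicate hj) (by simp)

theorem tgt_le_of_mem_ext {M : ℕ} {β : Fin (M + 1) → ℕ} {G : LongEdgeGraph}
    (hG : maxv G ≤ M + 1) {x : ExtLabel M} (hx : x ∈ ext β G) : ExtLabel.tgt x ≤ M + 1 := by
  rcases mem_ext hx with ⟨e, he, rfl⟩ | ⟨j, rfl⟩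
  · exact (le_maxv he).trans hG
  · exact j.2

theorem ExtLabel.src_lt_tgt {M : ℕ} (x : ExtLabel M) : ExtLabel.src x < ExtLabel.tgt x := by
  cases x with
  | inl e => exact e.src_lt_tgt
  | inr j => exact Nat.lt_succ_self _

/-- An extended ordering only prescribes the comparisons between vertices and of an edge with its
own ends; the others follow by transitivity through a vertex. The bound on `maxv G` ensures that the
ends of all edges are among the listed vertices. -/
theorem ExtOrdering.rel_of_prec {M : ℕ} {β : Fin (M + 1) → ℕ} {G : LongEdgeGraph}
    (hG : maxv G ≤ M + 1) (o : ExtOrdering β G) {x y : ExtItem β G}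
    (h : (itemLetter β G x).prec (itemLetter β G y)) : o.rel x y := by
  have := o.total
  have hv : ∀ a b : Fin (M + 2), ∀ z, (a : ℕ) ≤ b → o.rel (Sum.inl b) z → o.rel (Sum.inl a) z :=
    fun a b z hab hz => by
      rcases eq_or_lt_of_le hab with h | h
      · rwa [Fin.ext h]
      · exact _root_.trans (o.vertices a b h) hz
  have hs : ∀ e : (ext β G).ToType, ExtLabel.tgt e.1 < M + 2 := fun e =>
    Nat.lt_succ_of_le (tgt_le_of_mem_ext hG (Multiset.coe_mem (x := e)))
  have hl : ∀ (e : (ext β G).ToType) (a : Fin (M + 2)), (a : ℕ) ≤ ExtLabel.src e.1 →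
      o.rel (Sum.inl a) (Sum.inr e) := fun e a ha =>
    hv a ⟨ExtLabel.src e.1, (ExtLabel.src_lt_tgt _).trans (hs e)⟩ _ ha (o.after_src e _ rfl)
  rcases x with a | e <;> rcases y with b | f <;>
    simp only [itemLetter, Letter.prec, lo_extLetter] at h
  · exact o.vertices a b (by simp only [Letter.hi, Letter.lo] at h; exact Fin.lt_def.mpr (by omega))
  · exact hl f a (by simp only [Letter.hi] at h; omega)
  · have h1 := hi_extLetter e.1
    simp only [Letter.lo] at h
    have h2 : ExtLabel.tgt e.1 ≤ b := by omega
    have h3 := o.before_tgt e ⟨ExtLabel.tgt e.1, hs e⟩ rfl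
    rcases eq_or_lt_of_le h2 with h | h
    · exact o.before_tgt e b h.symm
    · exact _root_.trans h3 (o.vertices _ b h)
  · have h1 := hi_extLetter e.1
    exact _root_.trans (o.before_tgt e ⟨ExtLabel.tgt e.1, hs e⟩ rfl) (hl f _ (by simp only; omega))

/-- An order compatible with the precedences of the letters is an extended ordering. -/
def ExtOrdering.ofPrec {M : ℕ} {β : Fin (M + 1) → ℕ} {G : LongEdgeGraph}
    (r : ExtItem β G → ExtItem β G → Prop) (hr : IsStrictTotalOrder (ExtItem β G) r)
    (h : ∀ x y, (itemLetter β G x).prec (itemLetter β G y) → r x y) : ExtOrdering β G where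
  rel := r
  total := hr
  vertices a b hab := h _ _ (by
    have := Fin.lt_def.mp hab
    simp only [itemLetter, Letter.prec, Letter.hi, Letter.lo]
    omega)
  after_src e a ha := h _ _ (by
    simp only [itemLetter, Letter.prec, Letter.hi, lo_extLetter]
    omega)
  before_tgt e a ha := h _ _ (by
    have := hi_extLetter e.1
    simp only [itemLetter, Letter.prec, Letter.lo]
    omega)

theorem itemLetter_map {M : ℕ} {β : Fin (M + 1) → ℕ} {G : LongEdgeGraph}
    {σ : Equiv.Perm (ext β G).ToType} (hσ : ∀ e, (σ e).1 = e.1) (x : ExtItem β G) :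
    itemLetter β G (Sum.map id σ x) = itemLetter β G x := by
  cases x with
  | inl a => rfl
  | inr e => simp [itemLetter, hσ]

/-- A permutation of the vertices and edges that preserves the letters permutes the edges and
fixes the vertices. -/
theorem exists_edge_perm {M : ℕ} {β : Fin (M + 1) → ℕ} {G : LongEdgeGraph}
    (τ : Equiv.Perm (ExtItem β G)) (hτ : ∀ x, itemLetter β G (τ x) = itemLetter β G x) :
    ∃ σ : Equiv.Perm (ext β G).ToType, (∀ e, (σ e).1 = e.1) ∧ ∀ x, Sum.map id σ x = τ x := by
  have hl : ∀ a, τ (Sum.inl a) = Sum.inl a := fun a => by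
    have h := hτ (Sum.inl a)
    rcases hx : τ (Sum.inl a) with b | f
    · rw [hx] at h
      simp only [itemLetter, Letter.vertex.injEq] at h
      rw [Fin.ext h]
    · rw [hx] at h
      rcases hf : f.1 with e | j <;> simp [itemLetter, hf, extLetter] at h
  have hr : ∀ e, ∃ f, τ (Sum.inr e) = Sum.inr f ∧ f.1 = e.1 := fun e => by
    have h := hτ (Sum.inr e)
    rcases hx : τ (Sum.inr e) with b | f
    · rw [← hl b] at hx
      exact absurd (τ.injective hx) (by simp)
    · rw [hx] at h
      exact ⟨f, rfl, extLetter_injective h⟩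
  choose s hs hs1 using hr
  have hbij : Function.Bijective s := by
    refine (Finite.injective_iff_bijective).mp fun e f hef => ?_
    have : τ (Sum.inr e) = τ (Sum.inr f) := by rw [hs, hs, hef]
    exact Sum.inr_injective (τ.injective this)
  refine ⟨Equiv.ofBijective s hbij, hs1, ?_⟩
  rintro (a | e)
  · exact (hl a).symm
  · exact (hs e).symm

/-- Reading the labels in increasing order turns an ordering into a word. Orderings have the same
word exactly when a label-preserving permutation relates them, and such a permutation fixes the
vertices because their labels are distinct. -/
theorem card_extOrderings {M : ℕ} (β : Fin (M + 1) → ℕ) (G : LongEdgeGraph)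
    (hG : maxv G ≤ M + 1) :
    Nat.card (Quotient (extSetoid β G)) =
      numWords Letter.prec (letters (M + 1) (extendZero β) G) := by
  have hen : ∀ o : ExtOrdering β G, ∃ l : List (ExtItem β G),
      (l : Multiset (ExtItem β G)) = Finset.univ.val ∧ l.Pairwise o.rel := fun o => by
    have := o.total
    exact exists_enumeration o.rel
  choose E hE hE' using hen
  have hiff : ∀ o o' : ExtOrdering β G, (extSetoid β G).r o o' ↔
      (E o).map (itemLetter β G) = (E o').map (itemLetter β G) := by
    intro o o'
    have := o.total
    have := o'.total
    constructor
    · rintro ⟨σ, h1, h2⟩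
      have h3 : (E o).map (Sum.map id σ) = E o' := by
        refine enumeration_unique o'.rel ?_ (hE o') ?_ (hE' o')
        · rw [← Multiset.map_coe, hE o]
          have := Finset.map_univ_equiv (Equiv.sumCongr (Equiv.refl (Fin (M + 2))) σ)
          exact congrArg Finset.val this
        · rw [List.pairwise_map]
          exact (hE' o).imp fun h => (h2 _ _).mpr h
      rw [← h3, List.map_map]
      exact List.map_congr_left fun x _ => (itemLetter_map h1 x).symm
    · intro h
      obtain ⟨τ, h1, h2⟩ := exists_perm_of_map_eq (itemLetter β G) (hE o) (hE o') (hE' o) (hE' o') h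
      obtain ⟨σ, h3, h4⟩ := exists_edge_perm τ h1
      exact ⟨σ, h3, fun x y => by rw [h4, h4]; exact h2 x y⟩
  unfold numWords
  refine Nat.card_eq_of_bijective (Quotient.lift (s := extSetoid β G)
    (fun o => ⟨(E o).map (itemLetter β G), ?_, ?_⟩) ?_) ⟨?_, ?_⟩
  · rw [← Multiset.map_coe, hE, map_itemLetter]
  · rw [List.pairwise_map]
    refine (hE' o).imp fun {x y} h h' => ?_
    have := o.total
    exact irrefl x (_root_.trans h (o.rel_of_prec hG h'))
  · intro o o' h
    exact Subtype.ext ((hiff o o').mp h)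
  · intro q q'
    induction q using Quotient.ind
    induction q' using Quotient.ind
    intro h
    exact Quotient.sound ((hiff _ _).mpr (congrArg Subtype.val h))
  · rintro ⟨w, hw, hp⟩
    rw [← map_itemLetter] at hw
    obtain ⟨l, hl, rfl⟩ := exists_map_eq_of_coe_eq _ hw
    obtain ⟨r, hr, hlr⟩ := exists_order_of_enumeration hl
    -- A word without forbidden pairs, lifted to an enumeration, defines an order that respects all
    -- precedences.
    let o : ExtOrdering β G := ExtOrdering.ofPrec r hr fun x y hxy => by
      rw [List.pairwise_map] at hp
      obtain ⟨i, hi, rfl⟩ := List.mem_iff_getElem.mp (mem_enumeration hl x)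
      obtain ⟨j, hj, rfl⟩ := List.mem_iff_getElem.mp (mem_enumeration hl y)
      rw [rel_getElem_iff r hlr]
      rcases lt_trichotomy i j with h | rfl | h
      · exact h
      · exact absurd hxy (Letter.prec_irrefl _)
      · exact absurd hxy (List.pairwise_iff_getElem.mp hp j i hj hi h)
    refine ⟨Quotient.mk _ o, Subtype.ext ?_⟩
    change (E o).map (itemLetter β G) = _
    rw [enumeration_unique r (hE o) hl (hE' o) hlr]

/-- Sequences on `ℕ` allow counts with different `M` to be compared. -/
theorem P_eq_wordCount {M : ℕ} (β : Fin (M + 1) → ℕ) (G : LongEdgeGraph) (hG : maxv G ≤ M + 1) :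
    P β G = wordCount (M + 1) (extendZero β) G := by
  have h : Allowable β G ↔ ∀ j < M + 1, lam G (j + 1) ≤ extendZero β j := by
    refine ⟨fun h j hj => ?_, fun h => ⟨hG, fun j => ?_⟩⟩
    · rw [extendZero, dif_pos hj]
      exact h.2 ⟨j, hj⟩
    · rw [← extendZero_coe β]
      exact h j j.2
  unfold P wordCount
  simp only [h, card_extOrderings β G hG]

/-! ### Independence of the word count of the ambient interval -/

theorem lam_eq_zero {H : LongEdgeGraph} {n j : ℕ} (hH : ∀ e ∈ H, e.tgt ≤ n) (hj : n < j) :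
    lam H j = 0 := by
  unfold lam
  rw [Multiset.filter_eq_nil.mpr fun e he h => by have := hH e he; omega]
  rfl

theorem mem_letters {n : ℕ} {b : ℕ → ℕ} {H : LongEdgeGraph} {x : Letter} (hx : x ∈ letters n b H) :
    (∃ a ≤ n, x = Letter.vertex a) ∨ (∃ e ∈ H, x = Letter.edge e) ∨
      ∃ j < n, x = Letter.short j := by
  rw [letters, Multiset.mem_add, Multiset.mem_add, Multiset.mem_map, Multiset.mem_map,
    Multiset.mem_sum] at hx
  rcases hx with ⟨a, ha, rfl⟩ | ⟨e, he, rfl⟩ | ⟨j, hj, hx⟩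
  · exact Or.inl ⟨a, Nat.lt_succ_iff.mp (Finset.mem_range.mp ha), rfl⟩
  · exact Or.inr (Or.inl ⟨e, he, rfl⟩)
  · exact Or.inr (Or.inr ⟨j, Finset.mem_range.mp hj, Multiset.eq_of_mem_replicate hx⟩)

/-- The new letters, the vertex `n + 1` and the unweighted edges from `n` to `n + 1`, are comparable
to or equal to every letter, so each has only one place. -/
theorem wordCount_succ {n : ℕ} (b : ℕ → ℕ) {H : LongEdgeGraph} (hH : ∀ e ∈ H, e.tgt ≤ n) :
    wordCount (n + 1) b H = wordCount n b H := by
  have h0 : lam H (n + 1) = 0 := lam_eq_zero hH (Nat.lt_succ_self n)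
  have h1 : letters (n + 1) b H =
      (Letter.vertex (n + 1) ::ₘ Multiset.replicate (b n) (Letter.short n)) + letters n b H := by
    rw [letters, letters, Finset.sum_range_succ, h0, Nat.sub_zero, Finset.range_add_one,
      Finset.insert_val_of_notMem (by simp), Multiset.map_cons]
    simp only [← Multiset.singleton_add]
    abel
  have h2 : (∀ j < n + 1, lam H (j + 1) ≤ b j) ↔ ∀ j < n, lam H (j + 1) ≤ b j := by
    refine ⟨fun h j hj => h j (hj.trans (Nat.lt_succ_self n)), fun h j hj => ?_⟩
    rcases Nat.lt_succ_iff_lt_or_eq.mp hj with hj | rfl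
    · exact h j hj
    · rw [h0]
      exact Nat.zero_le _
  unfold wordCount
  simp only [h2]
  rw [h1, numWords_add Letter.prec_irrefl Letter.prec_trans]
  intro x hx y hy
  have hx' : x = Letter.vertex (n + 1) ∨ x = Letter.short n := by
    rcases Multiset.mem_cons.mp hx with h | h
    · exact Or.inl h
    · exact Or.inr (Multiset.eq_of_mem_replicate h)
  rw [← h1] at hy
  rcases mem_letters hy with ⟨a, ha, rfl⟩ | ⟨e, he, rfl⟩ | ⟨j, hj, rfl⟩ <;>
    rcases hx' with rfl | rfl <;>
    simp only [Letter.vertex.injEq, Letter.short.injEq, reduceCtorEq, Letter.prec, Letter.lo,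
      Letter.hi, false_or]
  · omega
  · omega
  · have := hH e he; omega
  · have := hH e he; have := e.src_lt_tgt; omega
  · omega
  · omega

theorem wordCount_add {n : ℕ} (b : ℕ → ℕ) {H : LongEdgeGraph} (hH : ∀ e ∈ H, e.tgt ≤ n) (k : ℕ) :
    wordCount (n + k) b H = wordCount n b H := by
  induction k with
  | zero => rfl
  | succ k ih =>
    rw [← Nat.add_assoc, wordCount_succ b fun e he => (hH e he).trans (Nat.le_add_right n k), ih]

theorem wordCount_eq {m n : ℕ} (b : ℕ → ℕ) {H : LongEdgeGraph} (hm : ∀ e ∈ H, e.tgt ≤ m)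
    (hn : ∀ e ∈ H, e.tgt ≤ n) : wordCount m b H = wordCount n b H := by
  rw [← wordCount_add b hm n, ← wordCount_add b hn m, Nat.add_comm]

/-! ### Reversal -/

/-- The edge reflected by `i ↦ N - i` if it lies in `0, …, N`; other edges are kept. -/
def LongEdge.rev (N : ℕ) (e : LongEdge) : LongEdge :=
  if h : e.tgt ≤ N then
    { src := N - e.tgt
      tgt := N - e.src
      wt := e.wt
      src_lt_tgt := by have := e.src_lt_tgt; omega
      wt_pos := e.wt_pos
      not_short := by have := e.not_short; have := e.src_lt_tgt; omega }
  else e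

section

variable {N : ℕ} {e : LongEdge}

theorem LongEdge.rev_src (h : e.tgt ≤ N) : (e.rev N).src = N - e.tgt := by simp [rev, h]

theorem LongEdge.rev_tgt (h : e.tgt ≤ N) : (e.rev N).tgt = N - e.src := by simp [rev, h]

theorem LongEdge.rev_wt : (e.rev N).wt = e.wt := by unfold rev; split <;> rfl

/-- Because edges outside the interval are kept, this needs no bound on `e`. -/
theorem LongEdge.rev_rev : (e.rev N).rev N = e := by
  by_cases h : e.tgt ≤ N
  · have h1 : (e.rev N).tgt ≤ N := by rw [rev_tgt h]; omega
    have := e.src_lt_tgt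
    ext
    · rw [rev_src h1, rev_tgt h]; omega
    · rw [rev_tgt h1, rev_src h]; omega
    · rw [rev_wt, rev_wt]
  · have h1 : e.rev N = e := by simp [rev, h]
    rw [h1, h1]

end

/-- The graph reflected by `i ↦ N - i`. -/
def rev (N : ℕ) (G : LongEdgeGraph) : LongEdgeGraph := G.map (LongEdge.rev N)

theorem rev_rev (N : ℕ) (G : LongEdgeGraph) : rev N (rev N G) = G := by
  simp [rev, Multiset.map_map, LongEdge.rev_rev]

theorem tgt_rev_le {N : ℕ} {G : LongEdgeGraph} (hG : ∀ e ∈ G, e.tgt ≤ N) :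
    ∀ e ∈ rev N G, e.tgt ≤ N := by
  intro e he
  obtain ⟨f, hf, rfl⟩ := Multiset.mem_map.mp he
  rw [LongEdge.rev_tgt (hG f hf)]
  exact Nat.sub_le _ _

/-- The gap between `j` and `j + 1` is carried to the gap between `N - 1 - j` and `N - j`; the index
is written to match `β_j` with `β_{N-1-j}`. -/
theorem lam_rev {N : ℕ} {G : LongEdgeGraph} (hG : ∀ e ∈ G, e.tgt ≤ N) {j : ℕ} (hj : j < N) :
    lam (rev N G) (j + 1) = lam G (N - 1 - j + 1) := by
  unfold lam rev
  rw [Multiset.filter_map, Multiset.map_map]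
  refine congrArg Multiset.sum ?_
  rw [Multiset.filter_congr (q := fun e => e.src < N - 1 - j + 1 ∧ N - 1 - j + 1 ≤ e.tgt)]
  · exact Multiset.map_congr rfl fun e _ => LongEdge.rev_wt
  · intro e he
    have h := hG e he
    have := e.src_lt_tgt
    simp only [Function.comp, LongEdge.rev_src h, LongEdge.rev_tgt h]
    omega

theorem lamBar_rev {N : ℕ} {G : LongEdgeGraph} (hG : ∀ e ∈ G, e.tgt ≤ N) {j : ℕ} (hj : j < N) :
    lamBar (rev N G) (j + 1) = lamBar G (N - 1 - j + 1) := by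
  unfold lamBar
  rw [lam_rev hG hj, rev, Multiset.filter_map, Multiset.card_map]
  congr 2
  refine Multiset.filter_congr fun e he => ?_
  have h := hG e he
  have := e.src_lt_tgt
  simp only [Function.comp, LongEdge.rev_src h, LongEdge.rev_tgt h]
  omega

/-- The letter reflected by `i ↦ N - i`. -/
def Letter.rev (N : ℕ) : Letter → Letter
  | vertex a => vertex (N - a)
  | edge e => edge (e.rev N)
  | short j => short (N - 1 - j)

/-- On intervals the reflection is `t ↦ 2N - t`, which exchanges left and right ends and so reverses
precedence. -/
theorem lo_hi_rev {N : ℕ} {b : ℕ → ℕ} {H : LongEdgeGraph} (hH : ∀ e ∈ H, e.tgt ≤ N)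
    {x : Letter} (hx : x ∈ letters N b H) :
    (x.rev N).lo + x.hi = 2 * N ∧ (x.rev N).hi + x.lo = 2 * N := by
  rcases mem_letters hx with ⟨a, ha, rfl⟩ | ⟨e, he, rfl⟩ | ⟨j, hj, rfl⟩ <;>
    simp only [Letter.rev, Letter.lo, Letter.hi]
  · omega
  · have h := hH e he
    have := e.src_lt_tgt
    rw [LongEdge.rev_src h, LongEdge.rev_tgt h]
    omega
  · omega

theorem letters_rev {N : ℕ} {b c : ℕ → ℕ} (hbc : ∀ j < N, c j = b (N - 1 - j))
    {H : LongEdgeGraph} (hH : ∀ e ∈ H, e.tgt ≤ N) :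
    letters N b (rev N H) = (letters N c H).map (Letter.rev N) := by
  unfold letters
  rw [Multiset.map_add, Multiset.map_add, Multiset.map_map, Multiset.map_map]
  congr 1
  · have : ((Finset.range (N + 1)).val.map fun a => N - a) = (Finset.range (N + 1)).val := by
      have h := Finset.sum_range_reflect (fun a => ({a} : Multiset ℕ)) (N + 1)
      have hs : ∀ f : ℕ → ℕ, ∑ a ∈ Finset.range (N + 1), ({f a} : Multiset ℕ) =
          (Finset.range (N + 1)).val.map f := fun f => by
        change ((Finset.range (N + 1)).val.map ((fun x => ({x} : Multiset ℕ)) ∘ f)).sum = _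
        rw [← Multiset.map_map (fun x => ({x} : Multiset ℕ)) f,
          Multiset.sum_map_singleton]
      rw [hs, hs (fun a => a), Multiset.map_id'] at h
      exact h
    conv_lhs => rw [← this, Multiset.map_map]
    rfl
  · congr 1
    · rw [rev, Multiset.map_map]
      rfl
    · rw [← Multiset.coe_mapAddMonoidHom, map_sum, ← Finset.sum_range_reflect]
      refine Finset.sum_congr rfl fun j hj => ?_
      have hj := Finset.mem_range.mp hj
      rw [Multiset.coe_mapAddMonoidHom, Multiset.map_replicate, hbc j hj,
        lam_rev hH (show N - 1 - j < N by omega), show N - 1 - (N - 1 - j) = j by omega]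
      rfl

theorem wordCount_rev {N : ℕ} {b c : ℕ → ℕ} (hbc : ∀ j < N, c j = b (N - 1 - j))
    {H : LongEdgeGraph} (hH : ∀ e ∈ H, e.tgt ≤ N) :
    wordCount N b (rev N H) = wordCount N c H := by
  have h : (∀ j < N, lam (rev N H) (j + 1) ≤ b j) ↔ ∀ j < N, lam H (j + 1) ≤ c j := by
    constructor <;> intro h j hj
    · have h1 := h (N - 1 - j) (by omega)
      rwa [lam_rev hH (by omega), ← hbc j hj, show N - 1 - (N - 1 - j) = j by omega] at h1
    · have h1 := h (N - 1 - j) (by omega)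
      rwa [hbc _ (by omega), ← lam_rev hH hj, show N - 1 - (N - 1 - j) = j by omega] at h1
  unfold wordCount
  simp only [h]
  rw [letters_rev hbc hH, numWords_map_reverse]
  · intro x hx
    rcases mem_letters hx with ⟨a, ha, rfl⟩ | ⟨e, he, rfl⟩ | ⟨j, hj, rfl⟩ <;>
      simp only [Letter.rev, Letter.vertex.injEq, LongEdge.rev_rev, Letter.short.injEq] <;> omega
  · intro x hx y hy
    have h1 := lo_hi_rev hH hx
    have h2 := lo_hi_rev hH hy
    unfold Letter.prec
    omega

theorem partitions_rev (N : ℕ) {G : LongEdgeGraph} {i : ℕ} {f : Fin i → LongEdgeGraph}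
    (hf : f ∈ partitions G i) : (fun j => rev N (f j)) ∈ partitions (rev N G) i := by
  simp only [partitions, Finset.mem_filter, Fintype.mem_piFinset, Multiset.mem_toFinset,
    Multiset.mem_powerset] at hf ⊢
  refine ⟨fun j => Multiset.map_le_map (hf.1 j), fun j => ?_, ?_⟩
  · rw [rev, Ne, Multiset.map_eq_zero]
    exact hf.2.1 j
  · rw [← hf.2.2, rev, ← Multiset.coe_mapAddMonoidHom, map_sum]
    rfl

/-- Partitions of `G` are reflected part by part. The lengths of `β` and `β'` are unrelated: each
part lies in `0, …, N`, so only the entries below `N` matter. -/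
theorem Phi_rev {M M' N : ℕ} {β : Fin (M + 1) → ℕ} {β' : Fin (M' + 1) → ℕ} {G : LongEdgeGraph}
    (hG : ∀ e ∈ G, e.tgt ≤ N) (hM : maxv (rev N G) ≤ M + 1) (hM' : maxv G ≤ M' + 1)
    (hβ : ∀ j < N, extendZero β' j = extendZero β (N - 1 - j)) :
    Phi β (rev N G) = Phi β' G := by
  have key : ∀ H ≤ G, P β (rev N H) = P β' H := fun H hH => by
    have h1 : ∀ e ∈ H, e.tgt ≤ N := fun e he => hG e (Multiset.mem_of_le hH he)
    have h2 : maxv H ≤ M' + 1 :=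
      maxv_le_iff.mpr fun e he => maxv_le_iff.mp hM' e (Multiset.mem_of_le hH he)
    have h3 : maxv (rev N H) ≤ M + 1 := maxv_le_iff.mpr fun e he =>
      maxv_le_iff.mp hM e (Multiset.mem_of_le (Multiset.map_le_map hH) he)
    rw [P_eq_wordCount β _ h3, P_eq_wordCount β' _ h2,
      wordCount_eq _ (maxv_le_iff.mp h3) (tgt_rev_le h1), wordCount_rev hβ h1,
      wordCount_eq _ h1 (maxv_le_iff.mp h2)]
  unfold Phi
  have hcard : Multiset.card (rev N G) = Multiset.card G := Multiset.card_map _ _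
  rw [hcard]
  refine Finset.sum_congr rfl fun i _ => ?_
  congr 1
  refine Finset.sum_nbij' (fun f j => rev N (f j)) (fun f j => rev N (f j)) ?_ ?_ ?_ ?_ ?_
  · intro f hf
    have := partitions_rev N hf
    rwa [rev_rev] at this
  · exact fun f hf => partitions_rev N hf
  · exact fun f _ => funext fun j => rev_rev _ _
  · exact fun f _ => funext fun j => rev_rev _ _
  · intro f hf
    refine Finset.prod_congr rfl fun j _ => ?_
    simp only [partitions, Finset.mem_filter, Fintype.mem_piFinset, Multiset.mem_toFinset,
      Multiset.mem_powerset] at hf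
    have h1 : rev N (f j) ≤ G := by
      have := Multiset.map_le_map (f := LongEdge.rev N) (hf.1 j)
      rwa [← rev, ← rev, rev_rev] at this
    rw [← key _ h1, rev_rev]

/-! ### Reversal of the linear functions -/

/-- The linear function with the first `N` variables reversed and the others omitted. -/
def revLin (N : ℕ) (f : LinFun) : LinFun where
  const := f.const
  coeff j := if j < N then f.coeff (N - 1 - j) else 0

/-- The two hypotheses say that an index in only one of the two ranges contributes zero, through its
coefficient or through the extension by zero. -/
theorem LinFun.eval_eq_sum_range {M : ℕ} (f : LinFun) (β : Fin (M + 1) → ℕ) {n : ℕ}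
    (h : ∀ j, (M < j ∨ f.coeff j = 0) ∨ j < n) (h' : ∀ j < n, j ≤ M ∨ extendZero β j = 0) :
    f.eval (fun i => (β i : ℤ)) = f.const + ∑ j ∈ Finset.range n, f.coeff j * extendZero β j := by
  have h1 : ∑ i : Fin (M + 1), f.coeff i * ((β i : ℤ) : ℚ) =
      ∑ j ∈ Finset.range (M + 1), f.coeff j * extendZero β j := by
    rw [Finset.sum_range]
    exact Finset.sum_congr rfl fun i _ => by rw [extendZero_coe, Int.cast_natCast]
  rw [LinFun.eval, h1]
  congr 1
  have h2 : ∀ a b : ℕ, (∀ j, j < a → ¬ j < b → f.coeff j * (extendZero β j : ℚ) = 0) →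
      ∑ j ∈ Finset.range a, f.coeff j * (extendZero β j : ℚ) =
        ∑ j ∈ Finset.range (max a b), if j < a ∧ j < b then f.coeff j * (extendZero β j : ℚ)
          else 0 := by
    intro a b hab
    rw [← Finset.sum_filter]
    symm
    refine Finset.sum_subset (fun j hj => ?_) fun j hj hj' => ?_
    · simp only [Finset.mem_filter, Finset.mem_range] at hj ⊢
      omega
    · simp only [Finset.mem_filter, Finset.mem_range] at hj hj'
      exact hab j hj (by omega)
  rw [h2 (M + 1) n, h2 n (M + 1), max_comm]
  · simp only [and_comm]
  · intro j hj hj'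
    rcases h' j hj with h | h
    · omega
    · rw [h, Nat.cast_zero, mul_zero]
  · intro j hj hj'
    rcases h j with (h | h) | h
    · omega
    · rw [h, zero_mul]
    · omega

theorem IsLinearization.rev {G : LongEdgeGraph} {f : LinFun} (hf : IsLinearization G f) {N : ℕ}
    (hN : 1 ≤ N) (hG : ∀ e ∈ G, e.tgt ≤ N) : IsLinearization (rev N G) (revLin N f) := by
  intro M β hβ
  obtain ⟨N, rfl⟩ : ∃ K, N = K + 1 := ⟨N - 1, by omega⟩
  -- The reversed sequence has exactly the length of the interval of reflection, so coefficients of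
  -- `f` beyond it never enter. Where `β` is too short it is padded by zeros; no edge of the
  -- reflected graph reaches there, so semiallowability survives.
  let β' : Fin (N + 1) → ℕ := fun j => extendZero β (N - j)
  have hβ' : ∀ j < N + 1, extendZero β' j = extendZero β (N + 1 - 1 - j) := fun j hj => by
    rw [extendZero, dif_pos hj]
    rfl
  have hmax : maxv G ≤ N + 1 := maxv_le_iff.mpr hG
  have hsemi : Semiallowable β' G := by
    refine ⟨hmax, fun j => ?_⟩
    have h1 := lamBar_rev hG (j := N - j) (by omega)
    rw [show N + 1 - 1 - (N - j) = (j : ℕ) by omega] at h1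
    change _ ≤ extendZero β (N - j)
    rw [← h1]
    by_cases h : N - j < M + 1
    · rw [extendZero, dif_pos h]
      exact hβ.2 ⟨N - j, h⟩
    · have : lam (Severi.rev (N + 1) G) (N - j + 1) = 0 :=
        lam_eq_zero (maxv_le_iff.mp hβ.1) (by omega)
      rw [lamBar, this, Nat.zero_sub]
      exact Nat.zero_le _
  rw [Phi_rev hG hβ.1 hmax hβ', hf N β' hsemi, LinFun.eval_eq_sum_range (n := N + 1),
    LinFun.eval_eq_sum_range (n := N + 1), ← Finset.sum_range_reflect]
  · congr 1
    refine Finset.sum_congr rfl fun j hj => ?_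
    have hj := Finset.mem_range.mp hj
    rw [hβ' _ (by omega), show N + 1 - 1 - (N + 1 - 1 - j) = j by omega]
    simp only [revLin, if_pos hj]
  · intro j
    by_cases h : j < N + 1
    · exact Or.inr h
    · exact Or.inl (Or.inr (if_neg h))
  · intro j hj
    by_cases h : j < M + 1
    · left; omega
    · right; simp [extendZero, h]
  · intro j; omega
  · intro j hj; left; omega

theorem PhiLin_eq {G : LongEdgeGraph} {f : LinFun} (hf : IsLinearization G f) : PhiLin G = f := by
  have h : ∃ f, IsLinearization G f := ⟨f, hf⟩
  rw [PhiLin, dif_pos h]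
  exact h.choose_spec.unique hf

theorem PhiLin_rev {G : LongEdgeGraph} {N : ℕ} (hN : 1 ≤ N) (hG : ∀ e ∈ G, e.tgt ≤ N) :
    PhiLin (rev N G) = revLin N (PhiLin G) := by
  by_cases h : ∃ f, IsLinearization G f
  · obtain ⟨f, hf⟩ := h
    rw [PhiLin_eq hf, PhiLin_eq (hf.rev hN hG)]
  -- Without a linearization of `G` there is none of its reflection either, and both sides are the
  -- default zero.
  · have h' : ¬ ∃ f, IsLinearization (rev N G) f := fun ⟨f, hf⟩ => h ⟨revLin N f, by
      have := hf.rev hN (tgt_rev_le hG)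
      rwa [rev_rev] at this⟩
    rw [PhiLin, dif_neg h', PhiLin, dif_neg h]
    ext <;> simp [revLin]

theorem shift_eq_rev_rev {G : LongEdgeGraph} {N : ℕ} (hG : ∀ e ∈ G, e.tgt ≤ N) (k : ℕ) :
    shift k G = rev (N + k) (rev N G) := by
  unfold shift rev
  rw [Multiset.map_map]
  refine Multiset.map_congr rfl fun e he => ?_
  have h := hG e he
  have h1 : (e.rev N).tgt ≤ N + k := by rw [LongEdge.rev_tgt h]; omega
  have := e.src_lt_tgt
  ext
  · rw [Function.comp, LongEdge.rev_src h1, LongEdge.rev_tgt h, LongEdge.shift]; simp only; omega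
  · rw [Function.comp, LongEdge.rev_tgt h1, LongEdge.rev_src h, LongEdge.shift]; simp only; omega
  · rw [Function.comp, LongEdge.rev_wt, LongEdge.rev_wt, LongEdge.shift]

/-- Two reversals of variables translate the coefficients; those outside the window of `N` variables
vanish. -/
theorem PhiLin_shift {G : LongEdgeGraph} {N : ℕ} (hN : 1 ≤ N) (hG : ∀ e ∈ G, e.tgt ≤ N) (k : ℕ) :
    PhiLin (shift k G) = ⟨(PhiLin G).const,
      fun j => if k ≤ j ∧ j < k + N then (PhiLin G).coeff (j - k) else 0⟩ := by
  rw [shift_eq_rev_rev hG, PhiLin_rev (by omega), PhiLin_rev hN hG]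
  · ext j
    · rfl
    · simp only [revLin]
      by_cases h1 : j < N + k
      · by_cases h2 : k ≤ j
        · rw [if_pos h1, if_pos (by omega), if_pos (by omega)]
          congr 1
          omega
        · rw [if_pos h1, if_neg (by omega), if_neg (by omega)]
      · rw [if_neg h1, if_neg (by omega)]
  · exact fun e he => (tgt_rev_le hG e he).trans (Nat.le_add_right _ _)

/-! ### Templates -/

theorem mem_verts {G : LongEdgeGraph} {v : ℕ} :
    v ∈ verts G ↔ ∃ e ∈ G, e.src = v ∨ e.tgt = v := by
  unfold verts
  rw [Multiset.mem_toFinset, Multiset.mem_add, Multiset.mem_map, Multiset.mem_map]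
  constructor
  · rintro (⟨e, he, h⟩ | ⟨e, he, h⟩)
    exacts [⟨e, he, Or.inl h⟩, ⟨e, he, Or.inr h⟩]
  · rintro ⟨e, he, h | h⟩
    exacts [Or.inl ⟨e, he, h⟩, Or.inr ⟨e, he, h⟩]

theorem minv_eq_zero_iff {G : LongEdgeGraph} (hG : G ≠ 0) : minv G = 0 ↔ ∃ e ∈ G, e.src = 0 := by
  have hne : (verts G : Set ℕ).Nonempty := by
    obtain ⟨e, he⟩ := Multiset.exists_mem_of_ne_zero hG
    exact ⟨e.src, mem_verts.mpr ⟨e, he, Or.inl rfl⟩⟩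
  constructor
  · intro h
    have h0 : minv G ∈ (verts G : Set ℕ) := Nat.sInf_mem hne
    rw [h, Finset.mem_coe, mem_verts] at h0
    obtain ⟨e, he, h⟩ := h0
    have := e.src_lt_tgt
    exact ⟨e, he, by omega⟩
  · rintro ⟨e, he, h⟩
    exact Nat.sInf_eq_zero.mpr (Or.inl (mem_verts.mpr ⟨e, he, Or.inl h⟩))

theorem exists_tgt_eq_maxv {G : LongEdgeGraph} (hG : G ≠ 0) : ∃ e ∈ G, e.tgt = maxv G := by
  obtain ⟨f, hf⟩ := Multiset.exists_mem_of_ne_zero hG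
  have hne : (verts G).Nonempty := ⟨f.src, mem_verts.mpr ⟨f, hf, Or.inl rfl⟩⟩
  obtain ⟨v, hv, h⟩ := Finset.exists_mem_eq_sup (verts G) hne id
  obtain ⟨e, he, rfl | rfl⟩ := mem_verts.mp hv
  · have h1 := le_maxv he
    have h2 := e.src_lt_tgt
    change maxv G = e.src at h
    omega
  · exact ⟨e, he, h.symm⟩

/-- The graph reflected so that its last vertex becomes the vertex `0`. -/
def reflect (G : LongEdgeGraph) : LongEdgeGraph := rev (maxv G) G

theorem mem_reflect {G : LongEdgeGraph} {e : LongEdge} :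
    e ∈ reflect G ↔ ∃ f ∈ G, f.rev (maxv G) = e := Multiset.mem_map

theorem reflect_ne_zero {G : LongEdgeGraph} (hG : G ≠ 0) : reflect G ≠ 0 := by
  rwa [reflect, rev, Ne, Multiset.map_eq_zero]

theorem minv_reflect {G : LongEdgeGraph} (hG : G ≠ 0) : minv (reflect G) = 0 := by
  rw [minv_eq_zero_iff (reflect_ne_zero hG)]
  obtain ⟨e, he, h⟩ := exists_tgt_eq_maxv hG
  exact ⟨_, mem_reflect.mpr ⟨e, he, rfl⟩, by rw [LongEdge.rev_src h.le, h, Nat.sub_self]⟩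

theorem maxv_reflect {G : LongEdgeGraph} (hG : G ≠ 0) (h0 : minv G = 0) :
    maxv (reflect G) = maxv G := by
  refine le_antisymm (maxv_le_iff.mpr (tgt_rev_le fun e he => le_maxv he)) ?_
  obtain ⟨e, he, h⟩ := (minv_eq_zero_iff hG).mp h0
  have h1 := le_maxv (mem_reflect.mpr ⟨e, he, rfl⟩)
  rwa [LongEdge.rev_tgt (le_maxv he), h, Nat.sub_zero] at h1

theorem reflect_reflect {G : LongEdgeGraph} (hG : G ≠ 0) (h0 : minv G = 0) :
    reflect (reflect G) = G := by
  rw [reflect, maxv_reflect hG h0, reflect, rev_rev]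

theorem len_eq_maxv {G : LongEdgeGraph} (h0 : minv G = 0) : len G = maxv G := by
  rw [len, h0, Nat.sub_zero]

theorem len_reflect {G : LongEdgeGraph} (hG : G ≠ 0) (h0 : minv G = 0) :
    len (reflect G) = len G := by
  rw [len_eq_maxv (minv_reflect hG), len_eq_maxv h0, maxv_reflect hG h0]

theorem IsTemplate.reflect {G : LongEdgeGraph} (hG : G ≠ 0) (h : IsTemplate G) :
    IsTemplate (reflect G) := by
  refine ⟨minv_reflect hG, fun i h1 h2 => ?_⟩
  rw [len_reflect hG h.1, len_eq_maxv h.1] at h2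
  obtain ⟨e, he, h3, h4⟩ := h.2 (maxv G - i) (by omega) (by rw [len_eq_maxv h.1]; omega)
  have h5 := le_maxv he
  refine ⟨_, mem_reflect.mpr ⟨e, he, rfl⟩, ?_, ?_⟩
  · rw [LongEdge.rev_src h5]; omega
  · rw [LongEdge.rev_tgt h5]; omega

theorem mult_reflect (G : LongEdgeGraph) : mult (reflect G) = mult G := by
  simp [mult, reflect, rev, Multiset.map_map, LongEdge.rev_wt]

theorem cogenus_reflect (G : LongEdgeGraph) : cogenus (reflect G) = cogenus G := by
  rw [cogenus, reflect, rev, Multiset.map_map, cogenus]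
  refine congrArg Multiset.sum (Multiset.map_congr rfl fun e he => ?_)
  have h := le_maxv he
  have := e.src_lt_tgt
  have hl : (e.rev (maxv G)).len = e.len := by
    rw [LongEdge.len, LongEdge.rev_src h, LongEdge.rev_tgt h, LongEdge.len]
    omega
  rw [Function.comp, hl, LongEdge.rev_wt]

theorem eps0_reflect {G : LongEdgeGraph} (hG : G ≠ 0) : eps0 (reflect G) = eps1 G := by
  have : (∀ e ∈ reflect G, e.src = minv (reflect G) ∨ e.tgt = minv (reflect G) → e.wt = 1) ↔
      ∀ e ∈ G, e.src = maxv G ∨ e.tgt = maxv G → e.wt = 1 := by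
    have hiff : ∀ e ∈ G, ((e.rev (maxv G)).src = 0 ∨ (e.rev (maxv G)).tgt = 0 ↔
        e.src = maxv G ∨ e.tgt = maxv G) := fun e he => by
      have h := le_maxv he
      have := e.src_lt_tgt
      rw [LongEdge.rev_src h, LongEdge.rev_tgt h]
      omega
    rw [minv_reflect hG]
    constructor
    · intro h e he h1
      rw [← LongEdge.rev_wt (N := maxv G)]
      exact h _ (mem_reflect.mpr ⟨e, he, rfl⟩) ((hiff e he).mpr h1)
    · intro h e he h1
      obtain ⟨f, hf, rfl⟩ := mem_reflect.mp he
      rw [LongEdge.rev_wt]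
      exact h f hf ((hiff f hf).mp h1)
  unfold eps0 eps1
  simp only [this]

theorem eps0_le_one (G : LongEdgeGraph) : eps0 G ≤ 1 := by unfold eps0; split <;> omega

theorem eps1_le_one (G : LongEdgeGraph) : eps1 G ≤ 1 := by unfold eps1; split <;> omega

theorem len_pos {G : LongEdgeGraph} (hG : G ≠ 0) (h0 : minv G = 0) : 1 ≤ len G := by
  obtain ⟨e, he, h⟩ := exists_tgt_eq_maxv hG
  have := e.src_lt_tgt
  rw [len_eq_maxv h0]
  omega

theorem eta_reflect {G : LongEdgeGraph} (hG : G ≠ 0) (h0 : minv G = 0) {j : ℕ} (hj : j < len G) :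
    eta (reflect G) (j + 1) = eta G (len G - 1 - j + 1) := by
  have h := len_pos hG h0
  rw [len_eq_maxv h0] at h hj ⊢
  simp only [eta, reflect, PhiLin_rev h fun e he => le_maxv he, revLin, if_pos hj]

/-- The lengths and the weights in excess of one bound the cogenus of a template from below. -/
theorem IsTemplate.len_add_excess_le {G : LongEdgeGraph} (h : IsTemplate G) :
    len G - 1 + ∑ e ∈ G.toFinset, e.len * (e.wt - 1) ≤ cogenus G := by
  have hsub : Finset.Ioo 0 (len G) ⊆ G.toFinset.biUnion fun e => Finset.Ioo e.src e.tgt := by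
    intro i hi
    obtain ⟨h1, h2⟩ := Finset.mem_Ioo.mp hi
    obtain ⟨e, he, h⟩ := h.2 i h1 h2
    simp only [Finset.mem_biUnion, Multiset.mem_toFinset, Finset.mem_Ioo]
    exact ⟨e, he, h⟩
  have h1 := (Finset.card_le_card hsub).trans Finset.card_biUnion_le
  simp only [Nat.card_Ioo] at h1
  rw [Nat.sub_zero] at h1
  refine (Nat.add_le_add_right h1 _).trans ?_
  rw [← Finset.sum_add_distrib]
  unfold cogenus
  rw [Finset.sum_multiset_map_count]
  refine Finset.sum_le_sum fun e he => ?_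
  have hc : 1 ≤ G.count e := Multiset.one_le_count_iff_mem.mpr (Multiset.mem_toFinset.mp he)
  have hw := e.wt_pos
  have hl := e.src_lt_tgt
  -- The term `ℓρ - 1` splits as `(ℓ - 1) + ℓ(ρ - 1)`: interior vertices, which together cover those
  -- of the template, and excess weight.
  have h2 : e.tgt - e.src - 1 + e.len * (e.wt - 1) = e.len * e.wt - 1 := by
    obtain ⟨w, hw⟩ : ∃ w, e.wt = w + 1 := ⟨e.wt - 1, by omega⟩
    rw [hw, Nat.add_sub_cancel, Nat.mul_add, Nat.mul_one]
    unfold LongEdge.len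
    omega
  rw [h2, smul_eq_mul]
  exact Nat.le_mul_of_pos_left _ hc

theorem exists_heavy_of_eps0 {G : LongEdgeGraph} (h0 : minv G = 0) (h : eps0 G = 0) :
    ∃ e ∈ G, e.src = 0 ∧ 2 ≤ e.wt := by
  unfold eps0 at h
  split_ifs at h with hh
  push Not at hh
  obtain ⟨e, he, h1, h2⟩ := hh
  have := e.src_lt_tgt
  have := e.wt_pos
  exact ⟨e, he, by omega, by omega⟩

theorem exists_heavy_of_eps1 {G : LongEdgeGraph} (h : eps1 G = 0) :
    ∃ e ∈ G, e.tgt = maxv G ∧ 2 ≤ e.wt := by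
  unfold eps1 at h
  split_ifs at h with hh
  push Not at hh
  obtain ⟨e, he, h1, h2⟩ := hh
  have := e.src_lt_tgt
  have := e.wt_pos
  have := le_maxv he
  exact ⟨e, he, by omega, by omega⟩

theorem LongEdge.one_le_excess {e : LongEdge} (h : 2 ≤ e.wt) : 1 ≤ e.len * (e.wt - 1) := by
  have := e.src_lt_tgt
  exact Nat.mul_pos (by unfold LongEdge.len; omega) (by omega)

/-- If `ε_0 = 0`, an edge at the first vertex has weight at least two, and its excess improves the
bound `ℓ - 1 ≤ δ` by one. This keeps the missing entries within the arithmetic part of `β`. -/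
theorem IsTemplate.len_le_cogenus_add_eps0 {G : LongEdgeGraph} (h : IsTemplate G) :
    len G ≤ cogenus G + eps0 G := by
  have h1 := h.len_add_excess_le
  rcases Nat.eq_zero_or_pos (eps0 G) with h0 | h0
  · obtain ⟨e, he, -, hw⟩ := exists_heavy_of_eps0 h.1 h0
    have h2 := Finset.single_le_sum (f := fun e : LongEdge => e.len * (e.wt - 1))
      (fun _ _ => Nat.zero_le _) (Multiset.mem_toFinset.mpr he)
    have h3 := LongEdge.one_le_excess hw
    omega
  · omega

theorem IsTemplate.len_le_cogenus_add_eps1 {G : LongEdgeGraph} (hG : G ≠ 0) (h : IsTemplate G) :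
    len G ≤ cogenus G + eps1 G := by
  have := (h.reflect hG).len_le_cogenus_add_eps0
  rwa [len_reflect hG h.1, cogenus_reflect, eps0_reflect hG] at this

/-- This makes the number `M - r` of shifts nonnegative and keeps the missing initial and final
segments disjoint. The delicate case is `ε_0 = ε_1 = 0`, where heavy edges at both ends must yield
`ℓ ≤ M`. -/
theorem IsTemplate.len_le_max {G : LongEdgeGraph} (hG : G ≠ 0) (h : IsTemplate G) {M : ℕ}
    (hM : 1 ≤ M) (hGM : cogenus G - 1 ≤ M) : len G ≤ M + eps0 G + eps1 G := by
  have h1 := h.len_add_excess_le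
  have h2 := h.len_le_cogenus_add_eps0
  have h3 := h.len_le_cogenus_add_eps1 hG
  have h4 := eps0_le_one G
  have h5 := eps1_le_one G
  by_cases hε : eps0 G = 0 ∧ eps1 G = 0
  · obtain ⟨e, he, hes, hew⟩ := exists_heavy_of_eps0 h.1 hε.1
    obtain ⟨f, hf, hft, hfw⟩ := exists_heavy_of_eps1 hε.2
    -- A single heavy edge joining both ends has excess at least `ℓ`, so `2ℓ - 1 ≤ δ ≤ M + 1`, which
    -- suffices for `M ≥ 1`. Two distinct heavy edges have total excess at least two.
    by_cases hef : e = f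
    · subst hef
      have h6 := Finset.single_le_sum (f := fun e : LongEdge => e.len * (e.wt - 1))
        (fun _ _ => Nat.zero_le _) (Multiset.mem_toFinset.mpr he)
      have h7 : e.len = len G := by rw [LongEdge.len, hes, hft, len_eq_maxv h.1, Nat.sub_zero]
      have h8 : e.len ≤ e.len * (e.wt - 1) := Nat.le_mul_of_pos_right _ (by omega)
      omega
    · have h6 : ∑ x ∈ ({e, f} : Finset LongEdge), x.len * (x.wt - 1) ≤
          ∑ x ∈ G.toFinset, x.len * (x.wt - 1) := by
        refine Finset.sum_le_sum_of_subset fun x hx => ?_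
        rcases Finset.mem_insert.mp hx with rfl | hx
        · exact Multiset.mem_toFinset.mpr he
        · rw [Finset.mem_singleton.mp hx]
          exact Multiset.mem_toFinset.mpr hf
      rw [Finset.sum_pair hef] at h6
      have h7 := LongEdge.one_le_excess hew
      have h8 := LongEdge.one_le_excess hfw
      omega
  · omega

/-! ### Summation over the templates of a given cogenus -/

theorem mem_templates {δ : ℕ} {G : LongEdgeGraph} :
    G ∈ templates δ ↔ IsTemplate G ∧ cogenus G = δ := by simp [templates]

theorem ne_zero_of_mem_templates {δ : ℕ} (hδ : 1 ≤ δ) {G : LongEdgeGraph} (hG : G ∈ templates δ) :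
    G ≠ 0 := by
  rintro rfl
  have h : cogenus 0 = δ := (mem_templates.mp hG).2
  simp only [cogenus, Multiset.map_zero, Multiset.sum_zero] at h
  omega

theorem sum_templates_reflect {δ : ℕ} (hδ : 1 ≤ δ) (F : LongEdgeGraph → ℚ) :
    ∑ G ∈ templates δ, F (reflect G) = ∑ G ∈ templates δ, F G := by
  have h : ∀ G ∈ templates δ, reflect G ∈ templates δ := fun G hG => by
    have h1 := mem_templates.mp hG
    exact mem_templates.mpr ⟨h1.1.reflect (ne_zero_of_mem_templates hδ hG),
      (cogenus_reflect G).trans h1.2⟩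
  have h' : ∀ G ∈ templates δ, reflect (reflect G) = G := fun G hG =>
    reflect_reflect (ne_zero_of_mem_templates hδ hG) (mem_templates.mp hG).1.1
  exact Finset.sum_nbij' reflect reflect h h h' h' fun _ _ => rfl

/-! ### The value of `Q` -/

theorem zeta_eq_sum_range (i : ℕ) (G : LongEdgeGraph) :
    zeta i G = ∑ j ∈ Finset.range (len G), (j.choose i : ℚ) * eta G (j + 1) := by
  rw [zeta, ← Finset.Ico_add_one_right_eq_Icc, Finset.sum_Ico_eq_sum_range, Nat.add_sub_cancel]
  refine Finset.sum_congr rfl fun j _ => ?_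
  rw [Nat.add_sub_cancel_left, Nat.add_comm]

/-- The sum of the numbers of terms missing at the beginning. -/
def missing (G : LongEdgeGraph) : ℚ :=
  ∑ j ∈ Finset.range (len G), eta G (j + 1) * ((j + 1 - eps0 G : ℕ) : ℚ)

/-- The sum of the numbers of pairs of terms missing at the beginning. -/
def missingPairs (G : LongEdgeGraph) : ℚ :=
  ∑ j ∈ Finset.range (len G), eta G (j + 1) * ((j + 1 - eps0 G).choose 2 : ℚ)

/-- Under `j ↦ ℓ - 1 - j` and `ε_0 ↦ ε_1` the number missing at the beginning becomes the number
missing at the end, so end corrections are the initial corrections of the reflected template. -/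
theorem sum_eta_reflect {G : LongEdgeGraph} (hG : G ≠ 0) (h0 : minv G = 0) (g : ℕ → ℚ) :
    ∑ j ∈ Finset.range (len (reflect G)),
        eta (reflect G) (j + 1) * g (j + 1 - eps0 (reflect G)) =
      ∑ j ∈ Finset.range (len G), eta G (j + 1) * g (len G - eps1 G - j) := by
  rw [len_reflect hG h0, ← Finset.sum_range_reflect]
  refine Finset.sum_congr rfl fun j hj => ?_
  have hj := Finset.mem_range.mp hj
  rw [eta_reflect hG h0 (by omega), eps0_reflect hG, show len G - 1 - (len G - 1 - j) = j by omega,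
    show len G - 1 - j + 1 - eps1 G = len G - eps1 G - j by omega]

/-- The point is that `(j + 1 - ε_0) + (ℓ - ε_1 - j) = 1 + r` does not involve `j`. -/
theorem missing_add_missing_reflect {G : LongEdgeGraph} (hG : G ≠ 0) (h0 : minv G = 0) :
    missing G + missing (reflect G) = zeta 0 G * (1 + redLen G) := by
  rw [missing, missing, sum_eta_reflect hG h0 fun n => (n : ℚ), zeta_eq_sum_range, Finset.sum_mul,
    ← Finset.sum_add_distrib]
  refine Finset.sum_congr rfl fun j hj => ?_
  have hj := Finset.mem_range.mp hj
  have h1 := eps0_le_one G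
  have h2 := eps1_le_one G
  rw [Nat.cast_sub (by omega), Nat.cast_sub (by omega), Nat.cast_sub (by omega), redLen,
    Nat.choose_zero_right]
  push_cast
  ring

/-- Pascal's rule: `binom(j + 1 - ε_0, 2) = binom(j, 2) + j (1 - ε_0)` for `ε_0` zero or one. -/
theorem missingPairs_eq (G : LongEdgeGraph) :
    missingPairs G = zeta 2 G + zeta 1 G * (1 - eps0 G) := by
  rw [missingPairs, zeta_eq_sum_range, zeta_eq_sum_range, Finset.sum_mul, ← Finset.sum_add_distrib]
  refine Finset.sum_congr rfl fun j _ => ?_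
  have h := eps0_le_one G
  interval_cases eps0 G
  · rw [Nat.sub_zero, Nat.choose_succ_succ]
    push_cast
    ring
  · rw [Nat.add_sub_cancel]
    push_cast
    ring

/-- A finite sequence as a function on the natural numbers. -/
def ofFin {M : ℕ} (β : Fin (M + 1) → ℤ) (j : ℕ) : ℚ := if h : j < M + 1 then (β ⟨j, h⟩ : ℚ) else 0

theorem ofFin_coe {M : ℕ} (β : Fin (M + 1) → ℤ) (j : Fin (M + 1)) : ofFin β j = β j :=
  dif_pos j.2

theorem eval_PhiLin_shift {M : ℕ} (β : Fin (M + 1) → ℤ) {G : LongEdgeGraph} (hG : G ≠ 0)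
    (h0 : minv G = 0) {k : ℕ} (hk : k + len G ≤ M + 1) :
    (PhiLin (shift k G)).eval β =
      eta G 0 + ∑ j ∈ Finset.range (len G), eta G (j + 1) * ofFin β (j + k) := by
  have hl := len_pos hG h0
  have hG' : ∀ e ∈ G, e.tgt ≤ len G := fun e he => by
    rw [len_eq_maxv h0]
    exact le_maxv he
  rw [PhiLin_shift hl hG', LinFun.eval]
  congr 1
  have h1 : ∑ i : Fin (M + 1), (if k ≤ (i : ℕ) ∧ (i : ℕ) < k + len G then
      (PhiLin G).coeff (i - k) else 0) * (β i : ℚ) =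
      ∑ i ∈ Finset.range (M + 1), if i ∈ Finset.Ico k (k + len G) then
        (PhiLin G).coeff (i - k) * ofFin β i else 0 := by
    rw [Finset.sum_range]
    refine Finset.sum_congr rfl fun i _ => ?_
    rw [ofFin_coe, ite_mul, zero_mul]
    simp only [Finset.mem_Ico]
  have h2 : (Finset.range (M + 1)).filter (· ∈ Finset.Ico k (k + len G)) =
      Finset.Ico k (k + len G) := by
    ext i
    simp only [Finset.mem_filter, Finset.mem_range, Finset.mem_Ico]
    omega
  simp only [h1]
  rw [← Finset.sum_filter, h2, Finset.sum_Ico_eq_sum_range, Nat.add_sub_cancel_left]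
  refine Finset.sum_congr rfl fun j _ => ?_
  rw [Nat.add_sub_cancel_left, Nat.add_comm k j, eta]

theorem sum_range_of_arith {b : ℕ → ℚ} {c : ℚ} {m : ℕ} (hb : ∀ i, i + 1 ≤ m → b i = b 0 + i * c)
    {n : ℕ} (hn : n ≤ m) : ∑ i ∈ Finset.range n, b i = n * b 0 + c * (n.choose 2 : ℚ) := by
  induction n with
  | zero => simp
  | succ n ih =>
    rw [Finset.sum_range_succ, ih (by omega), hb n hn, Nat.choose_succ_succ' n 1,
      Nat.choose_one_right]
    push_cast
    ring

theorem sum_Ico_of_arith {b : ℕ → ℚ} {c : ℚ} {m M : ℕ}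
    (hb : ∀ t, t + 1 ≤ m → b (M - t) = b M - t * c) {n : ℕ} (hn : n ≤ m) (hnM : n ≤ M + 1) :
    ∑ i ∈ Finset.Ico (M + 1 - n) (M + 1), b i = n * b M - c * (n.choose 2 : ℚ) := by
  have h1 : ∑ i ∈ Finset.Ico (M + 1 - n) (M + 1), b i = ∑ t ∈ Finset.range n, b (M - t) := by
    rw [Finset.sum_Ico_eq_sum_range, show M + 1 - (M + 1 - n) = n by omega,
      ← Finset.sum_range_reflect]
    refine Finset.sum_congr rfl fun j hj => ?_
    have hj := Finset.mem_range.mp hj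
    congr 1
    omega
  rw [h1, sum_range_of_arith (b := fun t => b (M - t)) (c := -c) (m := m) (fun t ht => ?_) hn,
    Nat.sub_zero]
  · ring
  · rw [hb t ht, Nat.sub_zero]
    ring

/-- The contribution of one template, before any symmetrization: `c` and `c'` are the common
differences of `β` at its beginning and end. -/
theorem QTemplate_eq {M : ℕ} (β : Fin (M + 1) → ℤ) {δ : ℕ} (hδ : 1 ≤ δ) (hM : 1 ≤ M)
    (hδM : δ - 1 ≤ M) {c c' : ℚ} (hb : ∀ i, i + 1 ≤ δ → ofFin β i = ofFin β 0 + i * c)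
    (hb' : ∀ t, t + 1 ≤ δ → ofFin β (M - t) = ofFin β M - t * c')
    {G : LongEdgeGraph} (hG : G ∈ templates δ) :
    QTemplate G β = mult G * (eta G 0 * (M - redLen G) +
      zeta 0 G * ∑ i ∈ Finset.range (M + 1), ofFin β i
      - ofFin β 0 * missing G - ofFin β M * missing (reflect G)
      - c * missingPairs G + c' * missingPairs (reflect G)) := by
  have hne := ne_zero_of_mem_templates hδ hG
  obtain ⟨hT, rfl⟩ := mem_templates.mp hG
  have hl := len_pos hne hT.1
  have h1 := hT.len_le_cogenus_add_eps0
  have h2 := hT.len_le_cogenus_add_eps1 hne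
  have h3 := hT.len_le_max hne hM hδM
  have h4 := eps0_le_one G
  have h5 := eps1_le_one G
  have hset : (Finset.range (M + 2)).filter (fun k => 1 ≤ k + eps0 G ∧ k + len G ≤ M + eps1 G) =
      Finset.Ico (1 - eps0 G) (M + 1 + eps1 G - len G) := by
    ext k
    simp only [Finset.mem_filter, Finset.mem_range, Finset.mem_Ico]
    omega
  rw [QTemplate, hset]
  congr 1
  have hev : ∀ k ∈ Finset.Ico (1 - eps0 G) (M + 1 + eps1 G - len G),
      (PhiLin (shift k G)).eval β =
        eta G 0 + ∑ j ∈ Finset.range (len G), eta G (j + 1) * ofFin β (j + k) := fun k hk => by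
    have := Finset.mem_Ico.mp hk
    exact eval_PhiLin_shift β hne hT.1 (by omega)
  rw [Finset.sum_congr rfl hev, Finset.sum_add_distrib, Finset.sum_const, Nat.card_Ico,
    nsmul_eq_mul, Finset.sum_comm]
  have hcard : ((M + 1 + eps1 G - len G - (1 - eps0 G) : ℕ) : ℚ) = M - redLen G := by
    rw [redLen, Nat.cast_sub (by omega), Nat.cast_sub (by omega), Nat.cast_sub (by omega)]
    push_cast
    ring
  have hterm : ∀ j ∈ Finset.range (len G),
      ∑ k ∈ Finset.Ico (1 - eps0 G) (M + 1 + eps1 G - len G), eta G (j + 1) * ofFin β (j + k) =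
        ((j.choose 0 : ℚ) * eta G (j + 1)) * ∑ i ∈ Finset.range (M + 1), ofFin β i
        - ofFin β 0 * (eta G (j + 1) * ((j + 1 - eps0 G : ℕ) : ℚ))
        - ofFin β M * (eta G (j + 1) * ((len G - eps1 G - j : ℕ) : ℚ))
        - c * (eta G (j + 1) * ((j + 1 - eps0 G).choose 2 : ℚ))
        + c' * (eta G (j + 1) * ((len G - eps1 G - j).choose 2 : ℚ)) := by
    intro j hj
    have hj := Finset.mem_range.mp hj
    -- The indices `0, …, M` split into the missing initial segment, the window swept by `j + k`,
    -- and the missing final segment.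
    have hsum := Finset.sum_range_add_sum_Ico (ofFin β) (show j + 1 - eps0 G ≤ M + 1 by omega)
    have hsum' := Finset.sum_Ico_consecutive (ofFin β)
      (show j + 1 - eps0 G ≤ M + 1 - (len G - eps1 G - j) by omega)
      (show M + 1 - (len G - eps1 G - j) ≤ M + 1 by omega)
    rw [sum_range_of_arith hb (show j + 1 - eps0 G ≤ cogenus G by omega), ← hsum',
      sum_Ico_of_arith hb' (show len G - eps1 G - j ≤ cogenus G by omega) (by omega)] at hsum
    have hshift : ∑ k ∈ Finset.Ico (1 - eps0 G) (M + 1 + eps1 G - len G), ofFin β (j + k) =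
        ∑ i ∈ Finset.Ico (j + 1 - eps0 G) (M + 1 - (len G - eps1 G - j)), ofFin β i := by
      rw [Finset.sum_Ico_add (ofFin β)]
      congr 2 <;> omega
    rw [← Finset.mul_sum, hshift, ← hsum, Nat.choose_zero_right]
    push_cast
    ring
  rw [Finset.sum_congr rfl hterm, hcard, Finset.sum_add_distrib, Finset.sum_sub_distrib,
    Finset.sum_sub_distrib, Finset.sum_sub_distrib, ← Finset.sum_mul, ← zeta_eq_sum_range,
    ← Finset.mul_sum, ← Finset.mul_sum, ← Finset.mul_sum, ← Finset.mul_sum,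
    missing, missing, missingPairs, missingPairs, sum_eta_reflect hne hT.1 fun n => (n : ℚ),
    sum_eta_reflect hne hT.1 fun n => (n.choose 2 : ℚ)]
  ring

/-! ### Area and differences of sequences of partial sums -/

theorem area_eq {M : ℕ} (hM : 1 ≤ M) (β : Fin (M + 1) → ℤ) :
    (area β : ℚ) = 2 * ∑ i ∈ Finset.range (M + 1), ofFin β i - ofFin β 0 - ofFin β M := by
  have h0 : ofFin β 0 = β 0 := ofFin_coe β 0
  have h1 : ofFin β M = β (Fin.last M) := ofFin_coe β (Fin.last M)
  have hne : (0 : Fin (M + 1)) ≠ Fin.last M := fun h => by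
    have := congrArg Fin.val h
    simp only [Fin.val_zero, Fin.val_last] at this
    omega
  have huniv : (Finset.univ : Finset (Fin (M + 1))) =
      insert 0 (insert (Fin.last M) (Finset.Ioo 0 (Fin.last M))) := by
    ext i
    simp only [Finset.mem_univ, Finset.mem_insert, Finset.mem_Ioo, true_iff, Fin.ext_iff,
      Fin.lt_def, Fin.val_zero, Fin.val_last]
    omega
  have hS : ∑ i ∈ Finset.range (M + 1), ofFin β i =
      β 0 + (β (Fin.last M) + ∑ i ∈ Finset.Ioo 0 (Fin.last M), (β i : ℚ)) := by
    rw [Finset.sum_range]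
    simp only [ofFin_coe]
    rw [huniv, Finset.sum_insert, Finset.sum_insert]
    · simp
    · simp [hne]
  rw [hS, h0, h1, area]
  push_cast
  ring

theorem partialSums_succ {M : ℕ} (d : Fin (M + 1) → ℤ) {i : ℕ} (hi : i + 1 < M + 1) :
    ofFin (partialSums d) (i + 1) = ofFin (partialSums d) i + d ⟨i + 1, hi⟩ := by
  have h : (Finset.Iic ⟨i + 1, hi⟩ : Finset (Fin (M + 1))) =
      insert ⟨i + 1, hi⟩ (Finset.Iic ⟨i, by omega⟩) := by
    ext j
    simp only [Finset.mem_insert, Finset.mem_Iic, Fin.le_def, Fin.ext_iff]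
    omega
  rw [ofFin, dif_pos hi, ofFin, dif_pos (by omega), partialSums, partialSums, h,
    Finset.sum_insert (by simp [Fin.le_def])]
  push_cast
  ring

theorem partialSums_arith {M δ : ℕ} {d : Fin (M + 1) → ℤ} {c : ℤ} (hδM : δ - 1 ≤ M)
    (hd : ∀ i : Fin (M + 1), 1 ≤ (i : ℕ) → (i : ℕ) ≤ δ - 1 → d i = c) {i : ℕ} (hi : i + 1 ≤ δ) :
    ofFin (partialSums d) i = ofFin (partialSums d) 0 + i * c := by
  induction i with
  | zero => simp
  | succ i ih =>
    rw [partialSums_succ d (by omega), ih (by omega), hd _ (by simp) (by simp only; omega)]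
    push_cast
    ring

theorem partialSums_arith_last {M δ : ℕ} {d : Fin (M + 1) → ℤ} {c : ℤ} (hδM : δ - 1 ≤ M)
    (hd : ∀ i : Fin (M + 1), M + 2 - δ ≤ (i : ℕ) → d i = c) {t : ℕ} (ht : t + 1 ≤ δ) :
    ofFin (partialSums d) (M - t) = ofFin (partialSums d) M - t * c := by
  induction t with
  | zero => simp
  | succ t ih =>
    have h := partialSums_succ d (i := M - (t + 1)) (by omega)
    rw [hd _ (by simp only; omega), show M - (t + 1) + 1 = M - t by omega, ih (by omega)] at h
    push_cast
    linarith

theorem idet_partialSums {M : ℕ} (hM : 1 ≤ M) (d : Fin (M + 1) → ℤ) :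
    idet (partialSums d) = d ⟨1, by omega⟩ - d (Fin.last M) := by
  obtain ⟨K, rfl⟩ : ∃ K, M = K + 1 := ⟨M - 1, by omega⟩
  have h1 := partialSums_succ d (i := 0) (by omega)
  have h2 := partialSums_succ d (i := K) (by omega)
  have e0 : ofFin (partialSums d) 0 = partialSums d 0 := ofFin_coe (partialSums d) 0
  have e1 : ofFin (partialSums d) (0 + 1) = partialSums d 1 := ofFin_coe (partialSums d) 1
  have e2 : ofFin (partialSums d) (K + 1) = partialSums d (Fin.last (K + 1)) :=
    ofFin_coe (partialSums d) (Fin.last (K + 1))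
  have e3 : ofFin (partialSums d) K = partialSums d (Fin.last (K + 1) - 1) := by
    rw [← ofFin_coe (partialSums d) (Fin.last (K + 1) - 1)]
    congr 1
    rw [Fin.coe_sub_one, if_neg (by simp [Fin.ext_iff])]
    rfl
  rw [e0, e1] at h1
  rw [e2, e3] at h2
  have h1' : partialSums d 1 = partialSums d 0 + d ⟨0 + 1, by omega⟩ := by exact_mod_cast h1
  have h2' : partialSums d (Fin.last (K + 1)) = partialSums d (Fin.last (K + 1) - 1)
    + d ⟨K + 1, by omega⟩ := by exact_mod_cast h2
  rw [idet, h1', h2']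
  have h3 : Fin.last (K + 1) = ⟨K + 1, by omega⟩ := rfl
  rw [h3]
  ring

/-- Reflection merges the corrections at the two ends: the totals of `missing` agree, hence each is
half the total of `ζ^0 (1 + r)`, and those of `missingPairs` combine to a multiple of `c - c'`. -/
theorem Q_eq {M : ℕ} (β : Fin (M + 1) → ℤ) {δ : ℕ} (hδ : 1 ≤ δ) (hM : 1 ≤ M)
    (hδM : δ - 1 ≤ M) {c c' : ℚ} (hb : ∀ i, i + 1 ≤ δ → ofFin β i = ofFin β 0 + i * c)
    (hb' : ∀ t, t + 1 ≤ δ → ofFin β (M - t) = ofFin β M - t * c') :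
    Q δ β = coefA δ * (area β : ℚ) + coefL δ * (LL β : ℚ) + coefH δ * (height β : ℚ)
      + coefD δ * (c - c') + coefC δ := by
  have hu : ∑ G ∈ templates δ, (mult G : ℚ) * missing (reflect G) =
      ∑ G ∈ templates δ, (mult G : ℚ) * missing G := by
    rw [← sum_templates_reflect hδ fun G => (mult G : ℚ) * missing G]
    simp only [mult_reflect]
  have hv : ∑ G ∈ templates δ, (mult G : ℚ) * missingPairs (reflect G) =
      ∑ G ∈ templates δ, (mult G : ℚ) * missingPairs G := by
    rw [← sum_templates_reflect hδ fun G => (mult G : ℚ) * missingPairs G]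
    simp only [mult_reflect]
  have huu : ∑ G ∈ templates δ, (mult G : ℚ) * missing G +
      ∑ G ∈ templates δ, (mult G : ℚ) * missing G =
      ∑ G ∈ templates δ, (mult G : ℚ) * zeta 0 G +
        ∑ G ∈ templates δ, (mult G : ℚ) * (zeta 0 G * redLen G) := by
    nth_rewrite 2 [← hu]
    rw [← Finset.sum_add_distrib, ← Finset.sum_add_distrib]
    refine Finset.sum_congr rfl fun G hG => ?_
    rw [← mul_add, missing_add_missing_reflect (ne_zero_of_mem_templates hδ hG)
      (mem_templates.mp hG).1.1]
    ring
  have hD : coefD δ = -∑ G ∈ templates δ, (mult G : ℚ) * missingPairs G := by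
    simp only [coefD, missingPairs_eq]
  have hH : coefH δ = ∑ G ∈ templates δ, (mult G : ℚ) * eta G 0 +
      ∑ G ∈ templates δ, (mult G : ℚ) * (zeta 0 G * redLen G) := by
    rw [coefH, ← Finset.sum_add_distrib]
    exact Finset.sum_congr rfl fun G _ => by ring
  have hQ : Q δ β = (M : ℚ) * ∑ G ∈ templates δ, (mult G : ℚ) * eta G 0
      - ∑ G ∈ templates δ, (mult G : ℚ) * (eta G 0 * redLen G)
      + (∑ i ∈ Finset.range (M + 1), ofFin β i) * ∑ G ∈ templates δ, (mult G : ℚ) * zeta 0 G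
      - ofFin β 0 * ∑ G ∈ templates δ, (mult G : ℚ) * missing G
      - ofFin β M * ∑ G ∈ templates δ, (mult G : ℚ) * missing (reflect G)
      - c * ∑ G ∈ templates δ, (mult G : ℚ) * missingPairs G
      + c' * ∑ G ∈ templates δ, (mult G : ℚ) * missingPairs (reflect G) := by
    simp only [Finset.mul_sum (templates δ)]
    rw [Q, ← Finset.sum_sub_distrib, ← Finset.sum_add_distrib, ← Finset.sum_sub_distrib,
      ← Finset.sum_sub_distrib, ← Finset.sum_sub_distrib, ← Finset.sum_add_distrib]
    refine Finset.sum_congr rfl fun G hG => ?_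
    rw [QTemplate_eq β hδ hM hδM hb hb' hG]
    ring
  have h0 : ofFin β 0 = β 0 := ofFin_coe β 0
  have h1 : ofFin β M = β (Fin.last M) := ofFin_coe β (Fin.last M)
  have hLL : (LL β : ℚ) = ofFin β 0 + ofFin β M + 2 * M := by
    rw [h0, h1, LL]
    push_cast
    ring
  have hh : (height β : ℚ) = M := by simp [height]
  rw [hQ, hu, hv, area_eq hM, hLL, hh, hH, hD, coefA, coefL, coefC]
  -- The total of `missing` occurs with the factor `-(β_0 + β_M)`, and `huu` evaluates its double.
  -- The terms `M ζ^0 r` from `L(δ) · 2M` and `H(δ) · M` cancel.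
  linear_combination (-(ofFin β 0 + ofFin β M) / 2) * huu

end Severi

end

theorem mainTheorem11 (δ M : ℕ) (hδ : 1 ≤ δ) (hM : 1 ≤ M) (hδM : δ - 1 ≤ M)
    (d : Fin (M + 1) → ℤ)
    (hfirst : ∀ i j : Fin (M + 1), 1 ≤ (i : ℕ) → (i : ℕ) ≤ δ - 1 →
      1 ≤ (j : ℕ) → (j : ℕ) ≤ δ - 1 → d i = d j)
    (hlast : ∀ i j : Fin (M + 1), M + 2 - δ ≤ (i : ℕ) → M + 2 - δ ≤ (j : ℕ) → d i = d j) :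
    Severi.Q δ (Severi.partialSums d) =
      Severi.coefA δ * (Severi.area (Severi.partialSums d) : ℚ)
        + Severi.coefL δ * (Severi.LL (Severi.partialSums d) : ℚ)
        + Severi.coefH δ * (Severi.height (Severi.partialSums d) : ℚ)
        + Severi.coefD δ * (Severi.idet (Severi.partialSums d) : ℚ)
        + Severi.coefC δ := by
  -- The common differences are `d_1` and `d_M`. For `δ = 1` the progressions have one term, and
  -- these choices still serve.
  have hb := fun i => Severi.partialSums_arith (d := d) (c := d ⟨1, by omega⟩) (i := i) hδM
    (fun i h1 h2 => hfirst i ⟨1, by omega⟩ h1 h2 le_rfl (h1.trans h2))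
  have hb' := fun t => Severi.partialSums_arith_last (d := d) (c := d (Fin.last M)) (t := t) hδM
    (fun i h => hlast i (Fin.last M) h (by rw [Fin.val_last]; have := i.2; omega))
  rw [Severi.Q_eq _ hδ hM hδM hb hb', Severi.idet_partialSums hM]
  push_cast
  rfl
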